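/- **Theorem 3.2.** Let $L$ be a relational language, let $\kappa\ge\omega$ be a cardinal and let $\mathbb X$ be an $L$-structure with domain of size $\kappa$ (e.g. with domain $\kappa$). Let $\mathbb P(\mathbb X)=\{f[X]: f \text{ is a self-embedding of } \mathbb X\}$, ordered by inclusion. Suppose that $\mathbb X$ is copy-dense, i.e. every $A\subseteq X$ with $|A|=\kappa$ contains some $C\in\mathbb P(\mathbb X)$; in particular, $\mathbb X$ may be constant (every permutation of $X$ is an automorphism of $\mathbb X$) or copy-maximal ($\mathbb P(\mathbb X)=[X]^\kappa$). For a preorder $P$, let $\mathrm{sq}(P)$ be its separative quotient, i.e. the antisymmetric quotient of $\langle P,\le^*\rangle$, where $p\le^* q\iff\forall r\le p\;\exists s\le r\;(s\le q)$. Let $\mathrm{ro}(P)$ be the Boolean algebra of regular open subsets of $P$, where the open sets are the downward closed ones. Put $\mathbb B_{\mathbb X}=\mathrm{ro}(\mathrm{sq}(\mathbb P(\mathbb X)))$. For a Boolean algebra $B$, let $B^+$ be the partial order of its nonzero elements. For cardinals $\lambda\ge\omega$ and $\mu\ge2$, let $\mathrm{Col}(\lambda,\mu)=\mathrm{ro}(\mathrm{sq}(\langle{}^{<\lambda}\mu,\supseteq\rangle))$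 be the collapsing algebra. Then: (a) $\mathbb B_{\mathbb X}\cong \mathrm{ro}\big((P(\kappa)/[\kappa]^{<\kappa})^+\big)$; (b) if $\kappa=\omega$, then $\mathbb B_{\mathbb X}\cong \mathrm{ro}\big((P(\omega)/\mathrm{Fin})^+\big)$; (c) if $2^\kappa=\kappa^+$ and $2^{\mathrm{cf}(\kappa)}=\mathrm{cf}(\kappa)^+$, then $\mathbb B_{\mathbb X}\cong\mathrm{Col}(\omega,2^\kappa)$ when $\mathrm{cf}(\kappa)>\omega$, and $\mathbb B_{\mathbb X}\cong\mathrm{Col}(\omega_1,2^\kappa)$ when $\mathrm{cf}(\kappa)=\omega$. -/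

import Mathlib

open Cardinal
open scoped FirstOrder

universe u v w

namespace CopyPoset

/-! ### Boolean completions of preorders -/

/-- The carrier of the separative modification of a preorder `P`. -/
def SepMod (P : Type u) : Type u := P

/-- The separative modification: `p ≤* q` iff every `r ≤ p` has an extension `s ≤ r` with
`s ≤ q`. -/
instance SepMod.instPreorder (P : Type u) [Preorder P] : Preorder (SepMod P) where
  le p q := ∀ r : P, r ≤ (p : P) → ∃ s : P, s ≤ r ∧ s ≤ (q : P)
  le_refl _ r hr := ⟨r, le_refl r, hr⟩
  le_trans a b c hab hbc r hr := by
    obtain ⟨s, hs, hsb⟩ := hab r hr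
    obtain ⟨t, hts, htc⟩ := hbc s hsb
    exact ⟨t, le_trans hts hs, htc⟩

/-- The separative quotient `sq P`: the antisymmetric quotient of the separative modification. -/
abbrev SepQuot (P : Type u) [Preorder P] : Type u :=
  Antisymmetrization (SepMod P) (· ≤ ·)

/-- The regular open algebra `ro P` of a preorder `P`, whose topology consists of the downward
closed sets. `LowerSet P` is the Heyting algebra of open sets, and its Heyting-regular elements
are the regular open sets; they form a Boolean algebra under inclusion. -/
abbrev RO (P : Type u) [Preorder P] : Type u := Heyting.Regular (LowerSet P)

/-- The pseudo-complement of an open set is the interior of its complement: it consists of the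
points that have no extension in the set. -/
theorem mem_compl_lowerSet {P : Type u} [Preorder P] (U : LowerSet P) (p : P) :
    p ∈ Uᶜ ↔ ∀ q ≤ p, q ∉ U := by
  constructor
  · intro hp q hq hU
    have h : Uᶜ ⊓ U ≤ ⊥ := by simp
    exact h (show q ∈ Uᶜ ⊓ U from ⟨Uᶜ.lower hq hp, hU⟩)
  · intro h
    have h' : LowerSet.Iic p ≤ Uᶜ := by
      rw [le_compl_iff_disjoint_right, disjoint_iff_inf_le]
      rintro x ⟨hx, hU⟩
      exact h x hx hU
    exact h' (show p ∈ LowerSet.Iic p from le_refl p)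

/-- An open set `U` is regular open iff it contains every point below which it is dense. -/
theorem isRegular_lowerSet_iff {P : Type u} [Preorder P] (U : LowerSet P) :
    Heyting.IsRegular U ↔ ∀ p, (∀ q ≤ p, ∃ r ≤ q, r ∈ U) → p ∈ U := by
  have key : ∀ p, p ∈ Uᶜᶜ ↔ ∀ q ≤ p, ∃ r ≤ q, r ∈ U := by
    intro p
    simp only [mem_compl_lowerSet]
    push Not
    exact Iff.rfl
  constructor
  · intro h p hp
    rw [← h.eq]
    exact (key p).2 hp
  · intro h
    refine le_antisymm (fun p hp => h p ((key p).1 hp)) le_compl_compl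

/-! ### Copies of a relational structure -/

section Copies

variable (L : FirstOrder.Language.{v, w}) (M : Type u) [L.Structure M]

/-- The set of copies of a structure `M` inside itself: the images of its self-embeddings. As a
type, it is ordered by inclusion. -/
def copies : Set (Set M) := {A | ∃ f : M ↪[L] M, Set.range f = A}

/-- The Boolean completion of the poset of copies of `M`: the regular open algebra of its
separative quotient. -/
abbrev BoolCopies : Type u := RO (SepQuot (copies L M))

/-- `M` is copy-dense: its copies form a dense subset of the poset of all subsets of `M` of size
`|M|`, ordered by inclusion. (A copy always has size `|M|`.) -/
def IsCopyDense : Prop :=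
  ∀ A : Set M, #A = #M → ∃ C ∈ copies L M, C ⊆ A

/-- `M` is copy-maximal: its copies are exactly the subsets of `M` of size `|M|`. -/
def IsCopyMaximal : Prop := copies L M = {A : Set M | #A = #M}

/-- `M` is constant: every permutation of the domain is an automorphism. -/
def IsConstant : Prop := ∀ e : Equiv.Perm M, ∃ φ : M ≃[L] M, ∀ x, φ x = e x

end Copies

/-! ### Quotients of power sets by ideals -/

/-- Subsets of `α`, compared modulo an ideal. -/
def SetMod {α : Type u} (_ : Order.Ideal (Set α)) : Type u := Set α

/-- `A ≤ B` modulo `I` iff `A \ B ∈ I`. -/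
instance SetMod.instPreorder {α : Type u} (I : Order.Ideal (Set α)) : Preorder (SetMod I) where
  le A B := (show Set α from A) \ (show Set α from B) ∈ I
  le_refl A := by
    have h : (show Set α from A) \ (show Set α from A) = ⊥ := Set.sdiff_self
    rw [h]
    exact I.bot_mem
  le_trans A B C hAB hBC := by
    refine I.lower ?_ (Order.Ideal.sup_mem hAB hBC)
    intro x hx
    by_cases hB : x ∈ (show Set α from B)
    · exact Or.inr ⟨hB, hx.2⟩
    · exact Or.inl ⟨hx.1, hB⟩

/-- The quotient `P(α)/I` with its Boolean order. -/
abbrev PowerQuot {α : Type u} (I : Order.Ideal (Set α)) : Type u :=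
  Antisymmetrization (SetMod I) (· ≤ ·)

/-- The class of a subset of `α` in `P(α)/I`. -/
def PowerQuot.mk {α : Type u} (I : Order.Ideal (Set α)) (A : Set α) : PowerQuot I :=
  toAntisymmetrization (α := SetMod I) (· ≤ ·) A

/-- Two sets have the same class in `P(α)/I` iff their symmetric difference belongs to `I`. -/
theorem PowerQuot.mk_eq_mk {α : Type u} (I : Order.Ideal (Set α)) (A B : Set α) :
    PowerQuot.mk I A = PowerQuot.mk I B ↔ symmDiff A B ∈ I := by
  have h : PowerQuot.mk I A = PowerQuot.mk I B ↔ (A \ B ∈ I ∧ B \ A ∈ I) := by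
    unfold PowerQuot.mk toAntisymmetrization
    exact Quotient.eq
  rw [h]
  exact ⟨fun h => Order.Ideal.sup_mem h.1 h.2,
    fun h => ⟨I.lower le_sup_left h, I.lower le_sup_right h⟩⟩

/-- The partial order `(P(α)/I)⁺` of nonzero elements of `P(α)/I`. -/
abbrev PosQuot {α : Type u} (I : Order.Ideal (Set α)) : Type u :=
  {a : PowerQuot I // a ≠ PowerQuot.mk I ∅}

/-- The ideal `[α]^{<κ}` of subsets of `α` of size less than an infinite cardinal `κ`. -/
def smallIdeal (κ : Cardinal.{u}) (hκ : ℵ₀ ≤ κ) (α : Type u) : Order.Ideal (Set α) where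
  carrier := {A | #A < κ}
  lower' _ _ hBA hA := lt_of_le_of_lt (mk_le_mk_of_subset hBA) hA
  nonempty' := ⟨∅, by simpa using lt_of_lt_of_le aleph0_pos hκ⟩
  directed' A hA B hB :=
    ⟨A ∪ B, lt_of_le_of_lt (mk_union_le A B) (add_lt_of_lt hκ hA hB),
      Set.subset_union_left, Set.subset_union_right⟩

/-- The ideal `Fin` of finite sets of natural numbers. -/
def finIdeal : Order.Ideal (Set ℕ) where
  carrier := {A | A.Finite}
  lower' _ _ hBA hA := Set.Finite.subset hA hBA
  nonempty' := ⟨∅, Set.finite_empty⟩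
  directed' A hA B hB :=
    ⟨A ∪ B, Set.Finite.union hA hB, Set.subset_union_left, Set.subset_union_right⟩

/-- The partial order `(P(κ)/[κ]^{<κ})⁺`. -/
abbrev CP (κ : Cardinal.{u}) (hκ : ℵ₀ ≤ κ) : Type u :=
  PosQuot (smallIdeal κ hκ κ.ord.ToType)

/-! ### Collapsing algebras -/

/-- The tree `^{<lam}κ` of sequences in `κ` of length less than `lam`: the length is an element
`len` of (the well order of type) `lam`, and the sequence is a function on the elements
below `len`. -/
structure CollTree (lam κ : Cardinal.{u}) : Type u where
  /-- the length of the sequence -/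
  len : lam.ord.ToType
  /-- the terms of the sequence -/
  val : {x : lam.ord.ToType // x < len} → κ.ord.ToType

/-- The reversed order: `s ≤ t` iff the sequence `s` extends the sequence `t`. -/
instance CollTree.instPreorder (lam κ : Cardinal.{u}) : Preorder (CollTree lam κ) where
  le s t := ∃ h : t.len ≤ s.len,
    ∀ x (hx : x < t.len), s.val ⟨x, lt_of_lt_of_le hx h⟩ = t.val ⟨x, hx⟩
  le_refl s := ⟨le_refl _, fun _ _ => rfl⟩
  le_trans a b c hab hbc := by
    obtain ⟨h₁, e₁⟩ := hab
    obtain ⟨h₂, e₂⟩ := hbc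
    exact ⟨le_trans h₂ h₁, fun x hx =>
      (e₁ x (lt_of_lt_of_le hx h₂)).trans (e₂ x hx)⟩

/-- The collapsing algebra `Col(lam, κ)`: the Boolean completion of the reversed tree
`^{<lam}κ`. -/
abbrev Col (lam κ : Cardinal.{u}) : Type u := RO (SepQuot (CollTree lam κ))

end CopyPoset

/-! Regular open algebras depend on a preorder only up to dense embedding
(`IsDenseEmb.nonempty_orderIso`). Copy-density makes the copies dense among the sets of size `κ`,
and two copies whose intersection has size `κ` contain a common copy. So the copies embed densely
into the positive sets modulo the small ideal (`isDenseEmb_copies`), and (a) and (b) follow by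
transporting this ideal along a bijection.

For (c), `nonempty_ro_succTree` recognizes a collapsing tree of height `θ` in any `θ`-closed order
of size at most `λ` with antichains of size `λ` below every point, provided that each `p` can be
shrunk to some `r p` so that the sets `r p` split into at most `θ` antichains. Levels of a tree of
maximal antichains are built so that level `γ` decides the `γ`-th of these antichains; every `p`
then has a node below it. Here `λ = 2 ^ κ = κ⁺`.

The shrinking is `HasRefinement`. For regular uncountable `κ`, `exists_families` supplies countably
many almost disjoint families such that every large set meets more than `κ` members of one of them
in large sets; a recursion of length at most `κ⁺` then chooses distinct members. For singular `κ`,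
this is applied at regular cardinals below `κ` inside small pieces of the domain, and the pieces are
glued along `cf κ` (`hasRefinement_of_cof_lt`). The gluing patterns number at most `2 ^ cf κ = (cf
κ)⁺`. For uncountable cofinality they are separated with countably many colours by the regular case
at `cf κ`; for countable cofinality each pattern is its own colour, which costs `ω₁` colours and
suits height `ω₁`, where closure comes from pseudo-intersections. For `κ = ω` the order has size at
most `ω₁`, so every point gets a colour of its own. -/

namespace CopyPoset

/-! ### Dense embeddings and regular open algebras -/

/-- Two elements of a preorder are compatible if they have a common lower bound. -/
def Compat {P : Type*} [Preorder P] (p q : P) : Prop := ∃ r, r ≤ p ∧ r ≤ q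

theorem Compat.symm {P : Type*} [Preorder P] {p q : P} (h : Compat p q) : Compat q p := by
  obtain ⟨r, h₁, h₂⟩ := h
  exact ⟨r, h₂, h₁⟩

theorem Compat.mono {P : Type*} [Preorder P] {p q p' q' : P} (h : Compat p q) (hp : p ≤ p')
    (hq : q ≤ q') : Compat p' q' := by
  obtain ⟨r, h₁, h₂⟩ := h
  exact ⟨r, h₁.trans hp, h₂.trans hq⟩

/-- A dense embedding of preorders (in the sense of forcing). -/
structure IsDenseEmb {P : Type*} {Q : Type*} [Preorder P] [Preorder Q] (e : P → Q) : Prop where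
  mono : ∀ p p', p ≤ p' → e p ≤ e p'
  compat : ∀ p p', Compat (e p) (e p') → Compat p p'
  dense : ∀ q, ∃ p, e p ≤ q

/-- Pulling back regular open sets along a dense embedding. -/
def IsDenseEmb.pull {P : Type u} {Q : Type v} [Preorder P] [Preorder Q] {e : P → Q}
    (h : IsDenseEmb e) (U : RO Q) : RO P :=
  ⟨⟨{p | e p ∈ U.val}, fun p q hqp hp => U.val.lower (h.mono q p hqp) hp⟩, by
    rw [isRegular_lowerSet_iff]
    intro p hp
    refine (isRegular_lowerSet_iff U.val).1 U.prop (e p) fun q hq => ?_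
    obtain ⟨p₁, hp₁⟩ := h.dense q
    obtain ⟨r, hr₁, hr⟩ := h.compat p₁ p ⟨e p₁, le_rfl, hp₁.trans hq⟩
    obtain ⟨s, hs, hsU⟩ := hp r hr
    exact ⟨e s, (h.mono _ _ (hs.trans hr₁)).trans hp₁, hsU⟩⟩

/-- A dense embedding induces an isomorphism of the regular open algebras. -/
theorem IsDenseEmb.nonempty_orderIso {P : Type u} {Q : Type v} [Preorder P] [Preorder Q]
    {e : P → Q} (h : IsDenseEmb e) : Nonempty (RO P ≃o RO Q) := by
  have hle : ∀ U V : RO Q, h.pull U ≤ h.pull V ↔ U ≤ V := by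
    intro U V
    constructor
    · intro hUV q hq
      refine (isRegular_lowerSet_iff V.val).1 V.prop q fun q' hq' => ?_
      obtain ⟨p, hp⟩ := h.dense q'
      exact ⟨e p, hp, hUV (show p ∈ (h.pull U).val from U.val.lower (hp.trans hq') hq)⟩
    · intro hUV p hp
      exact hUV hp
  let f : RO Q ↪o RO P := OrderEmbedding.ofMapLEIff h.pull hle
  refine ⟨(RelIso.ofSurjective f fun V => ?_).symm⟩
  -- The preimage of `V` is the regularization of the upward image: all points below which the
  -- elements lying above some `e p` with `p ∈ V` are dense.
  let U : LowerSet Q := ⟨{q | ∀ q' ≤ q, ∃ p ∈ V.val, e p ≤ q'},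
    fun q q₁ hq₁ hq q' hq' => hq q' (hq'.trans hq₁)⟩
  have hU : Heyting.IsRegular U := by
    rw [isRegular_lowerSet_iff]
    intro q hq q' hq'
    obtain ⟨r, hr, hrU⟩ := hq q' hq'
    obtain ⟨p, hp, hpr⟩ := hrU r le_rfl
    exact ⟨p, hp, hpr.trans hr⟩
  refine ⟨⟨U, hU⟩, Heyting.Regular.coe_injective (SetLike.ext fun p => ?_)⟩
  change (∀ q' ≤ e p, ∃ p ∈ V.val, e p ≤ q') ↔ p ∈ V.val
  constructor
  · intro hp
    refine (isRegular_lowerSet_iff V.val).1 V.prop p fun q hq => ?_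
    obtain ⟨p₂, hp₂, hle₂⟩ := hp (e q) (h.mono _ _ hq)
    obtain ⟨r, hr₂, hr⟩ := h.compat p₂ q ⟨e p₂, le_rfl, hle₂⟩
    exact ⟨r, hr, V.val.lower hr₂ hp₂⟩
  · intro hp q hq
    obtain ⟨p₁, hp₁⟩ := h.dense q
    obtain ⟨r, hr₁, hr⟩ := h.compat p₁ p ⟨e p₁, le_rfl, hp₁.trans hq⟩
    exact ⟨r, V.val.lower hr hp, (h.mono _ _ hr₁).trans hp₁⟩

/-- A common lower bound in the modified order becomes a genuine one after two successive
extensions, so separation creates no new compatibilities. -/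
theorem isDenseEmb_sepQuot (P : Type u) [Preorder P] :
    IsDenseEmb (fun p : P => (toAntisymmetrization (α := SepMod P) (· ≤ ·) p : SepQuot P)) where
  mono p p' h := by
    change ∀ r : P, r ≤ p → ∃ s : P, s ≤ r ∧ s ≤ p'
    exact fun r hr => ⟨r, le_rfl, hr.trans h⟩
  compat p p' h := by
    obtain ⟨r, h₁, h₂⟩ := h
    induction r using Antisymmetrization.ind with
    | _ r =>
      have h₁' : ∀ x : P, x ≤ r → ∃ s : P, s ≤ x ∧ s ≤ p := h₁
      have h₂' : ∀ x : P, x ≤ r → ∃ s : P, s ≤ x ∧ s ≤ p' := h₂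
      obtain ⟨s, hs, hsp⟩ := h₁' r le_rfl
      obtain ⟨t, ht, htp⟩ := h₂' s hs
      exact ⟨t, ht.trans hsp, htp⟩
  dense q := by
    induction q using Antisymmetrization.ind with
    | _ q => exact ⟨q, le_rfl⟩

theorem nonempty_ro_sepQuot (P : Type u) [Preorder P] : Nonempty (RO (SepQuot P) ≃o RO P) :=
  (isDenseEmb_sepQuot P).nonempty_orderIso.map OrderIso.symm

/-! ### Positive sets -/

/-- The preorder of the sets outside an ideal, compared modulo the ideal. -/
abbrev PosSet {α : Type u} (I : Order.Ideal (Set α)) : Type u :=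
  {A : SetMod I // (show Set α from A) ∉ I}

/-- The underlying set of a positive set. -/
def PosSet.set {α : Type u} {I : Order.Ideal (Set α)} (A : PosSet I) : Set α := A.1

theorem PosSet.compat_iff {α : Type u} {I : Order.Ideal (Set α)} (A B : PosSet I) :
    Compat A B ↔ A.set ∩ B.set ∉ I := by
  constructor
  · rintro ⟨C, hA, hB⟩ h
    refine C.2 (I.lower ?_ (I.sup_mem (I.sup_mem hA hB) h))
    intro x hx
    by_cases hxA : x ∈ A.set
    · by_cases hxB : x ∈ B.set
      · exact Or.inr ⟨hxA, hxB⟩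
      · exact Or.inl (Or.inr ⟨hx, hxB⟩)
    · exact Or.inl (Or.inl ⟨hx, hxA⟩)
  · intro h
    refine ⟨⟨(A.set ∩ B.set : Set α), h⟩, ?_, ?_⟩
    · refine I.lower ?_ I.bot_mem
      rintro x ⟨hx, hxA⟩
      exact hxA hx.1
    · refine I.lower ?_ I.bot_mem
      rintro x ⟨hx, hxA⟩
      exact hxA hx.2

theorem PowerQuot.mk_ne_iff {α : Type u} (I : Order.Ideal (Set α)) (A : Set α) :
    PowerQuot.mk I A ≠ PowerQuot.mk I ∅ ↔ A ∉ I := by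
  rw [Ne, PowerQuot.mk_eq_mk]
  simp [symmDiff]

theorem isDenseEmb_posQuot {α : Type u} (I : Order.Ideal (Set α)) :
    IsDenseEmb (fun A : PosSet I =>
      (⟨PowerQuot.mk I A.set, (PowerQuot.mk_ne_iff I A.set).2 A.2⟩ : PosQuot I)) where
  mono p p' h := h
  compat p p' h := by
    obtain ⟨⟨r, hr⟩, h₁, h₂⟩ := h
    induction r using Antisymmetrization.ind with
    | _ r => exact ⟨⟨r, (PowerQuot.mk_ne_iff I r).1 hr⟩, h₁, h₂⟩
  dense q := by
    obtain ⟨q, hq⟩ := q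
    induction q using Antisymmetrization.ind with
    | _ q => exact ⟨⟨q, (PowerQuot.mk_ne_iff I q).1 hq⟩, le_rfl⟩

/-! ### Copies -/

theorem mk_copy {L : FirstOrder.Language.{v, w}} {X : Type u} [L.Structure X] {A : Set X}
    (hA : A ∈ copies L X) : #A = #X := by
  obtain ⟨f, rfl⟩ := hA
  exact mk_range_eq f f.injective

theorem IsConstant.isCopyDense {L : FirstOrder.Language.{v, w}} [L.IsRelational] {X : Type u}
    [L.Structure X] [Infinite X] (h : IsConstant L X) : IsCopyDense L X := by
  intro A hA
  obtain ⟨g⟩ := Cardinal.eq.1 hA.symm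
  refine ⟨A, ?_, subset_rfl⟩
  refine ⟨⟨⟨fun x => (g x : X), fun x y hxy => g.injective (Subtype.ext hxy)⟩, ?_, ?_⟩, ?_⟩
  · intro n f
    exact isEmptyElim f
  · intro n r x
    have hinj : Function.Injective fun x => (g x : X) :=
      fun x y hxy => g.injective (Subtype.ext hxy)
    -- A relation sees only a finite tuple, and an injection between finite subsets of `X` extends
    -- to a permutation, hence to an automorphism.
    obtain ⟨e, he⟩ := Equiv.Perm.exists_extending_pair
      (fun i : Set.range x => (i : X)) (fun i => (g i : X)) Subtype.val_injective
      (hinj.comp Subtype.val_injective)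
    obtain ⟨φ, hφ⟩ := h e
    have hx : (fun y => (g y : X)) ∘ x = φ ∘ x := by
      funext i
      simp [hφ, he ⟨x i, i, rfl⟩]
    change FirstOrder.Language.Structure.RelMap r ((fun y => (g y : X)) ∘ x) ↔ _
    rw [hx]
    exact φ.map_rel r x
  · ext a
    constructor
    · rintro ⟨x, rfl⟩
      exact (g x).2
    · intro ha
      obtain ⟨x, hx⟩ := g.surjective ⟨a, ha⟩
      exact ⟨x, congrArg Subtype.val hx⟩

theorem isDenseEmb_copies {L : FirstOrder.Language.{v, w}} {X : Type u} [L.Structure X]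
    (hd : IsCopyDense L X) {β : Type*} (I : Order.Ideal (Set β)) (e : X ≃ β)
    (hI : ∀ A : Set X, e '' A ∈ I ↔ #A < #X) :
    IsDenseEmb (fun A : copies L X =>
      (⟨e '' A.1, fun h => ((hI _).1 h).ne (mk_copy A.2)⟩ : PosSet I)) where
  mono p p' h := by
    refine I.lower ?_ I.bot_mem
    rintro x ⟨hx, hx'⟩
    exact hx' (Set.image_mono h hx)
  compat p p' h := by
    rw [PosSet.compat_iff] at h
    change e '' p.1 ∩ e '' p'.1 ∉ I at h
    rw [← Set.image_inter e.injective, hI] at h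
    obtain ⟨C, hC, hsub⟩ := hd (p.1 ∩ p'.1) (le_antisymm (mk_set_le _) (not_lt.1 h))
    exact ⟨⟨C, hC⟩, fun x hx => (hsub hx).1, fun x hx => (hsub hx).2⟩
  dense q := by
    have hq : e '' (e ⁻¹' (PosSet.set q)) ∉ I := by
      rw [e.image_preimage]
      exact q.2
    rw [hI] at hq
    obtain ⟨C, hC, hsub⟩ := hd (e ⁻¹' (PosSet.set q)) (le_antisymm (mk_set_le _) (not_lt.1 hq))
    refine ⟨⟨C, hC⟩, I.lower ?_ I.bot_mem⟩
    rintro x ⟨⟨y, hy, rfl⟩, hx⟩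
    exact hx (hsub hy)

theorem nonempty_boolCopies_posSet {L : FirstOrder.Language.{v, w}} {X : Type u} [L.Structure X]
    (hd : IsCopyDense L X) {β : Type*} (I : Order.Ideal (Set β)) (e : X ≃ β)
    (hI : ∀ A : Set X, e '' A ∈ I ↔ #A < #X) :
    Nonempty (BoolCopies L X ≃o RO (PosSet I)) := by
  obtain ⟨f⟩ := nonempty_ro_sepQuot (copies L X)
  obtain ⟨g⟩ := (isDenseEmb_copies hd I e hI).nonempty_orderIso
  exact ⟨f.trans g⟩

/-! ### Transfinite choices -/

/-- Transfinite recursion with choices: a condition `C γ f`, which depends on the values of `f` up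
to `γ` only, can be achieved at all `γ` if it can be achieved step by step. -/
theorem exists_transfinite {Θ : Type*} {Z : Type*} [LinearOrder Θ] [WellFoundedLT Θ] [Nonempty Z]
    (C : Θ → (Θ → Z) → Prop)
    (hC : ∀ γ f g, (∀ β ≤ γ, f β = g β) → C γ f → C γ g)
    (step : ∀ γ f, (∀ β < γ, C β f) → ∃ z, C γ (Function.update f γ z)) :
    ∃ f, ∀ γ, C γ f := by
  classical
  let z₀ : Z := Classical.arbitrary Z
  -- The padding by `z₀` is harmless, because `C γ` ignores the values beyond `γ`.
  let ext : ∀ γ : Θ, (∀ β, β < γ → Z) → Θ → Z := fun γ prev β =>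
    if h : β < γ then prev β h else z₀
  let F : ∀ γ : Θ, (∀ β, β < γ → Z) → Z := fun γ prev =>
    if h : ∃ z, C γ (Function.update (ext γ prev) γ z) then h.choose else z₀
  let f : Θ → Z := WellFoundedLT.fix F
  have hf : ∀ γ, f γ = F γ fun β _ => f β := fun γ => WellFoundedLT.fix_eq F γ
  refine ⟨f, fun γ => ?_⟩
  induction γ using WellFoundedLT.induction with
  | ind γ ih =>
    have hagree : ∀ β < γ, ext γ (fun β _ => f β) β = f β := fun β hβ => by simp [ext, hβ]
    have hex : ∃ z, C γ (Function.update (ext γ fun β _ => f β) γ z) :=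
      step γ _ fun β hβ => hC β f _ (fun δ hδ => (hagree δ (hδ.trans_lt hβ)).symm) (ih β hβ)
    have hfγ : f γ = hex.choose := by
      rw [hf γ]
      exact dif_pos hex
    refine hC γ _ f (fun β hβ => ?_) hex.choose_spec
    rcases hβ.eq_or_lt with rfl | hlt
    · simp [hfγ]
    · rw [Function.update_of_ne hlt.ne, hagree β hlt]

/-- Transfinite choice of elements that are in a given relation to all the previous ones. -/
theorem exists_transfinite_rel {ι : Type*} {Z : Type*} [LinearOrder ι] [WellFoundedLT ι]
    [Nonempty Z] (Q : ι → Z → Prop) (R : ι → ι → Z → Z → Prop)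
    (step : ∀ a (g : ι → Z), ∃ z, Q a z ∧ ∀ b < a, R b a (g b) z) :
    ∃ f : ι → Z, ∀ a, Q a (f a) ∧ ∀ b < a, R b a (f b) (f a) := by
  refine exists_transfinite (fun a f => Q a (f a) ∧ ∀ b < a, R b a (f b) (f a)) ?_ ?_
  · rintro γ f g hfg ⟨h₁, h₂⟩
    rw [hfg γ le_rfl] at h₁ h₂
    exact ⟨h₁, fun b hb => hfg b hb.le ▸ h₂ b hb⟩
  · intro γ f _
    obtain ⟨z, hz, hz'⟩ := step γ f
    refine ⟨z, by simpa using hz, fun b hb => ?_⟩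
    rw [Function.update_of_ne hb.ne, Function.update_self]
    exact hz' b hb

/-- A pairwise related subset of `S` extends to a maximal one. -/
theorem exists_maximal_pairwise {Z : Type*} (r : Z → Z → Prop) (S s₀ : Set Z) (h₀ : s₀ ⊆ S)
    (hr : s₀.Pairwise r) :
    ∃ s, s₀ ⊆ s ∧ s ⊆ S ∧ s.Pairwise r ∧
      ∀ z ∈ S, z ∉ s → ∃ y ∈ s, y ≠ z ∧ ¬ (r y z ∧ r z y) := by
  obtain ⟨s, hs, hmax⟩ := zorn_subset_nonempty {s : Set Z | s ⊆ S ∧ s.Pairwise r}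
    (fun c hc hchain _ => ⟨⋃₀ c, ⟨Set.sUnion_subset fun t ht => (hc ht).1,
      (Set.pairwise_sUnion hchain.directedOn).2 fun t ht => (hc ht).2⟩,
      fun t ht => Set.subset_sUnion_of_mem ht⟩) s₀ ⟨h₀, hr⟩
  refine ⟨s, hs, hmax.prop.1, hmax.prop.2, fun z hz hzs => ?_⟩
  by_contra! hcon
  have hins : insert z s ∈ {s : Set Z | s ⊆ S ∧ s.Pairwise r} := by
    refine ⟨Set.insert_subset hz hmax.prop.1, hmax.prop.2.insert fun y hy hne => ?_⟩
    have := hcon y hy hne.symm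
    exact ⟨this.2, this.1⟩
  exact hzs (hmax.le_of_ge hins (Set.subset_insert z s) (Set.mem_insert z s))

/-! ### A characterization of the collapsing algebra -/

/-- Sequences whose length is a successor, as initial parts (including the index `ix`) of total
functions. -/
structure SuccTree (Θ : Type u) (Λ : Type v) where
  /-- the index of the last term -/
  ix : Θ
  /-- the terms -/
  fn : Θ → Λ

instance SuccTree.instPreorder (Θ : Type u) (Λ : Type v) [Preorder Θ] :
    Preorder (SuccTree Θ Λ) where
  le s t := t.ix ≤ s.ix ∧ ∀ x ≤ t.ix, s.fn x = t.fn x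
  le_refl s := ⟨le_rfl, fun _ _ => rfl⟩
  le_trans a b c hab hbc :=
    ⟨hbc.1.trans hab.1, fun x hx => (hab.2 x (hx.trans hbc.1)).trans (hbc.2 x hx)⟩

theorem exists_succ {Θ : Type*} [LinearOrder Θ] [WellFoundedLT Θ] [NoMaxOrder Θ] :
    ∃ S : Θ → Θ, ∀ x y, x < S y ↔ x ≤ y := by
  have h : ∀ y : Θ, ∃ z, ∀ x, x < z ↔ x ≤ y := by
    intro y
    obtain ⟨z, hz, hmin⟩ := WellFounded.has_min (wellFounded_lt (α := Θ)) (Set.Ioi y)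
      (exists_gt y)
    refine ⟨z, fun x => ⟨fun hx => not_lt.1 fun hxy => hmin x hxy hx, fun hx => hx.trans_lt hz⟩⟩
  exact ⟨fun y => (h y).choose, fun x y => (h y).choose_spec x⟩

/-- Sequences of successor length are dense in the tree: any sequence can be prolonged by one term.
A sequence with last index `ix` has length `S ix`; the values of `fn` beyond `ix` are ignored by the
order. -/
theorem nonempty_succTree_collTree (θ lam : Cardinal.{u}) (hθ : ℵ₀ ≤ θ) (hlam : lam ≠ 0) :
    Nonempty (RO (SuccTree θ.ord.ToType lam.ord.ToType) ≃o RO (CollTree θ lam)) := by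
  have hnm : NoMaxOrder θ.ord.ToType := Cardinal.noMaxOrder hθ
  have hne : Nonempty lam.ord.ToType := by
    rw [← mk_ne_zero_iff]
    simpa using hlam
  obtain ⟨S, hS⟩ := exists_succ (Θ := θ.ord.ToType)
  refine IsDenseEmb.nonempty_orderIso
    (e := fun s : SuccTree θ.ord.ToType lam.ord.ToType =>
      (⟨S s.ix, fun x => s.fn x⟩ : CollTree θ lam)) ⟨?_, ?_, ?_⟩
  · rintro s t ⟨h₁, h₂⟩
    exact ⟨le_of_forall_lt fun x hx => (hS _ _).2 (((hS _ _).1 hx).trans h₁),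
      fun x hx => h₂ x ((hS _ _).1 hx)⟩
  · intro s t
    wlog hst : s.ix ≤ t.ix generalizing s t with H
    · intro h
      exact (H t s (le_of_not_ge hst) h.symm).symm
    rintro ⟨r, ⟨h₁, e₁⟩, ⟨h₂, e₂⟩⟩
    refine ⟨t, ⟨hst, fun x hx => ?_⟩, le_rfl⟩
    have a := e₁ x ((hS _ _).2 hx)
    have b := e₂ x ((hS _ _).2 (hx.trans hst))
    exact b.symm.trans a
  · intro q
    classical
    refine ⟨⟨q.len, fun x => if h : x < q.len then q.val ⟨x, h⟩ else Classical.arbitrary _⟩, ?_, ?_⟩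
    · exact le_of_lt ((hS _ _).2 le_rfl)
    · intro x hx
      simp [hx]

/-- The enumeration of a maximal antichain in an open set all of whose elements decide a given
antichain. -/
theorem exists_deciding_antichain {P : Type u} [Preorder P] {Λ : Type u} (hP : #P ≤ #Λ)
    (hanti : ∀ p : P, ∃ g : Λ → P, (∀ a, g a ≤ p) ∧ ∀ a b, a ≠ b → ¬ Compat (g a) (g b))
    (A : Set P) (hA : ∀ a ∈ A, ∀ b ∈ A, a ≠ b → ¬ Compat a b) (U : LowerSet P)
    (hU : ∃ u, u ∈ U) :
    ∃ g : Λ → P, (∀ α, g α ∈ U) ∧ (∀ α β, α ≠ β → ¬ Compat (g α) (g β)) ∧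
      (∀ u ∈ U, ∃ α, Compat (g α) u) ∧ ∀ α, ∀ a ∈ A, Compat (g α) a → g α ≤ a := by
  obtain ⟨u, hu⟩ := hU
  -- `D` is dense in `U`. An antichain of size `#Λ` is pushed into `D` and then extended to a
  -- maximal one; its size is exactly `#Λ`, because `#P ≤ #Λ`.
  let D : Set P := {p | p ∈ U ∧ ∀ a ∈ A, Compat p a → p ≤ a}
  have hD : ∀ p ∈ U, ∃ q ≤ p, q ∈ D := by
    intro p hp
    by_cases h : ∃ a ∈ A, Compat p a
    · obtain ⟨a, ha, q, hqp, hqa⟩ := h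
      refine ⟨q, hqp, U.lower hqp hp, fun b hb hqb => ?_⟩
      by_contra hcon
      refine hA a ha b hb ?_ (hqb.mono hqa le_rfl)
      rintro rfl
      exact hcon hqa
    · push Not at h
      exact ⟨p, le_rfl, hp, fun a ha hpa => absurd hpa (h a ha)⟩
  obtain ⟨g, hg, hgi⟩ := hanti u
  choose d hdle hdD using hD
  let g' : Λ → P := fun α => d (g α) (U.lower (hg α) hu)
  have hg'i : ∀ α β, α ≠ β → ¬ Compat (g' α) (g' β) := fun α β hne h =>
    hgi α β hne (h.mono (hdle _ _) (hdle _ _))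
  have hrefl : ∀ p : P, Compat p p := fun p => ⟨p, le_rfl, le_rfl⟩
  have hginj : Function.Injective g' := by
    intro α β h
    by_contra hne
    exact hg'i α β hne (h ▸ hrefl _)
  obtain ⟨s, hs₀, hsD, hsp, hmax⟩ := exists_maximal_pairwise (fun p q : P => ¬ Compat p q) D
    (Set.range g') (by rintro _ ⟨α, rfl⟩; exact hdD _ _) (by
      rintro _ ⟨α, rfl⟩ _ ⟨β, rfl⟩ hne
      exact hg'i α β fun h => hne (h ▸ rfl))
  have hcard : #Λ = #s := by
    refine le_antisymm ?_ ((mk_set_le s).trans hP)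
    rw [← mk_range_eq g' hginj]
    exact mk_le_mk_of_subset hs₀
  obtain ⟨e⟩ := Cardinal.eq.1 hcard
  refine ⟨fun α => e α, fun α => (hsD (e α).2).1, fun α β hne => ?_, fun p hp => ?_,
    fun α => (hsD (e α).2).2⟩
  · exact hsp (e α).2 (e β).2 fun h => hne (e.injective (Subtype.ext h))
  · have hq := hdD p hp
    have : ∃ y ∈ s, Compat y (d p hp) := by
      by_cases hqs : d p hp ∈ s
      · exact ⟨_, hqs, hrefl _⟩
      · obtain ⟨y, hy, _, hyc⟩ := hmax _ hq hqs
        refine ⟨y, hy, ?_⟩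
        by_contra hcon
        exact hyc ⟨hcon, fun h => hcon h.symm⟩
    obtain ⟨y, hy, hc⟩ := this
    refine ⟨e.symm ⟨y, hy⟩, ?_⟩
    simpa using hc.mono le_rfl (hdle p hp)

/-- A closed preorder with large antichains, a dense subset of which is a union of few antichains,
has the same Boolean completion as a tree of sequences. -/
theorem nonempty_ro_succTree {P : Type u} [Preorder P] [Nonempty P] {Θ Λ : Type u} [LinearOrder Θ]
    [WellFoundedLT Θ] [Nonempty Λ] (hP' : #P ≤ #Λ)
    (hclosed : ∀ (γ : Θ) (f : Θ → P),
      (∀ β β', β ≤ β' → β' < γ → f β' ≤ f β) → ∃ p, ∀ β < γ, p ≤ f β)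
    (hanti : ∀ p : P, ∃ g : Λ → P,
      (∀ a, g a ≤ p) ∧ ∀ a b, a ≠ b → ¬ Compat (g a) (g b))
    (c : P → Θ) (r : P → P) (hr : ∀ p, r p ≤ p)
    (hcr : ∀ p q, p ≠ q → c p = c q → ¬ Compat (r p) (r q)) :
    Nonempty (RO P ≃o RO (SuccTree Θ Λ)) := by
  classical
  let A : Θ → Set P := fun γ => {a | ∃ p, c p = γ ∧ r p = a}
  have hA : ∀ γ, ∀ a ∈ A γ, ∀ b ∈ A γ, a ≠ b → ¬ Compat a b := by
    rintro γ _ ⟨p, hp, rfl⟩ _ ⟨q, hq, rfl⟩ hne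
    exact hcr p q (fun h => hne (h ▸ rfl)) (hp.trans hq.symm)
  have hG : ∀ (γ : Θ) (U : LowerSet P), ∃ g : Λ → P, (∃ u, u ∈ U) → (∀ α, g α ∈ U) ∧
      (∀ α β, α ≠ β → ¬ Compat (g α) (g β)) ∧
      (∀ u ∈ U, ∃ α, Compat (g α) u) ∧ ∀ α, ∀ a ∈ A γ, Compat (g α) a → g α ≤ a := by
    intro γ U
    by_cases hU : ∃ u, u ∈ U
    · obtain ⟨g, hg⟩ := exists_deciding_antichain hP' hanti (A γ) (hA γ) U hU
      exact ⟨g, fun _ => hg⟩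
    · exact ⟨fun _ => Classical.arbitrary P, fun h => absurd h hU⟩
  choose G hG using hG
  let low : (γ : Θ) → (∀ β, β < γ → P) → LowerSet P := fun γ f =>
    ⟨{p | ∀ β (hβ : β < γ), p ≤ f β hβ}, fun p q hqp hp β hβ => hqp.trans (hp β hβ)⟩
  -- `E s γ` is the node at level `γ` on the branch `s`: the member of index `s γ` of the chosen
  -- antichain below all earlier nodes of that branch.
  let E : (Θ → Λ) → Θ → P := fun s => WellFoundedLT.fix fun γ f => G γ (low γ f) (s γ)
  let U : (Θ → Λ) → Θ → LowerSet P := fun s γ => low γ fun β _ => E s β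
  have hE : ∀ s γ, E s γ = G γ (U s γ) (s γ) := fun s γ =>
    WellFoundedLT.fix_eq (fun γ f => G γ (low γ f) (s γ)) γ
  have hUmem : ∀ s γ p, p ∈ U s γ ↔ ∀ β < γ, p ≤ E s β := fun s γ p => Iff.rfl
  have hUcongr' : ∀ s t γ, (∀ β < γ, E s β = E t β) → U s γ = U t γ := by
    intro s t γ h
    refine SetLike.ext fun p => ?_
    rw [hUmem, hUmem]
    exact forall₂_congr fun β hβ => by rw [h β hβ]
  have hEcongr : ∀ s t γ, (∀ β ≤ γ, s β = t β) → E s γ = E t γ := by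
    intro s t γ
    induction γ using WellFoundedLT.induction with
    | ind γ ih =>
      intro h
      rw [hE, hE, h γ le_rfl, hUcongr' s t γ fun β hβ => ih β hβ fun δ hδ => h δ (hδ.trans hβ.le)]
  have hUcongr : ∀ s t γ, (∀ β < γ, s β = t β) → U s γ = U t γ := fun s t γ h =>
    hUcongr' s t γ fun β hβ => hEcongr s t β fun δ hδ => h δ (hδ.trans_lt hβ)
  have hmain : ∀ s γ, (∃ u, u ∈ U s γ) ∧ ∀ β < γ, E s γ ≤ E s β := by
    intro s γ
    induction γ using WellFoundedLT.induction with
    | ind γ ih =>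
      have hex : ∃ u, u ∈ U s γ := by
        refine hclosed γ (E s) fun β β' hle hlt => ?_
        rcases hle.eq_or_lt with rfl | h
        · exact le_rfl
        · exact (ih β' hlt).2 β h
      refine ⟨hex, ?_⟩
      rw [← hUmem, hE]
      exact (hG γ _ hex).1 _
  have hEle : ∀ s β γ, β ≤ γ → E s γ ≤ E s β := by
    intro s β γ h
    rcases h.eq_or_lt with rfl | h
    · exact le_rfl
    · exact (hmain s γ).2 β h
  -- Compatible nodes lie on a common branch: at the first difference they would be below distinct
  -- members of one antichain.
  have hinc : ∀ s t β γ, Compat (E s β) (E t γ) → β ≤ γ → ∀ δ ≤ β, s δ = t δ := by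
    intro s t β γ hc hβγ δ
    induction δ using WellFoundedLT.induction with
    | ind δ ih =>
      intro hδ
      by_contra hne
      have h₁ := hc.mono (hEle s δ β hδ) (hEle t δ γ (hδ.trans hβγ))
      rw [hE, hE, hUcongr s t δ fun x hx => ih x hx (hx.le.trans hδ)] at h₁
      exact (hG δ _ (hmain t δ).1).2.1 _ _ hne h₁
  -- Each level is predense. A decreasing sequence below `p` is built together with a branch whose
  -- nodes stay above it, with closure used at each stage.
  have hpre : ∀ (p : P) (γ : Θ), ∃ s, Compat (E s γ) p := by
    intro p γ
    obtain ⟨f, hf⟩ := exists_transfinite (Θ := Θ) (Z := P × Λ)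
      (fun γ f => (f γ).1 ≤ p ∧ (∀ β < γ, (f γ).1 ≤ (f β).1) ∧ (f γ).1 ≤ E (fun x => (f x).2) γ)
      (by
        intro γ f g hfg hC
        have hE' : E (fun x => (f x).2) γ = E (fun x => (g x).2) γ :=
          hEcongr _ _ γ fun β hβ => congrArg Prod.snd (hfg β hβ)
        rw [hfg γ le_rfl, hE'] at hC
        exact ⟨hC.1, fun β hβ => hfg β hβ.le ▸ hC.2.1 β hβ, hC.2.2⟩)
      (by
        intro γ f hf
        obtain ⟨q, hqp, hq⟩ : ∃ q ≤ p, ∀ β < γ, q ≤ (f β).1 := by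
          by_cases hbot : ∃ β, β < γ
          · obtain ⟨β₀, hβ₀⟩ := hbot
            obtain ⟨q, hq⟩ := hclosed γ (fun β => (f β).1) fun β β' hle hlt => by
              rcases hle.eq_or_lt with rfl | h
              · exact le_rfl
              · exact (hf β' hlt).2.1 β h
            exact ⟨q, (hq β₀ hβ₀).trans (hf β₀ hβ₀).1, hq⟩
          · push Not at hbot
            exact ⟨p, le_rfl, fun β hβ => absurd hβ (not_lt.2 (hbot β))⟩
        have hqU : q ∈ U (fun x => (f x).2) γ := by
          rw [hUmem]
          exact fun β hβ => (hq β hβ).trans (hf β hβ).2.2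
        obtain ⟨α, q', hq'g, hq'q⟩ := (hG γ _ ⟨q, hqU⟩).2.2.1 q hqU
        refine ⟨(q', α), ?_, ?_, ?_⟩
        · simpa using hq'q.trans hqp
        · intro β hβ
          rw [Function.update_of_ne hβ.ne]
          simpa using hq'q.trans (hq β hβ)
        · have hUu : U (fun x => (Function.update f γ (q', α) x).2) γ = U (fun x => (f x).2) γ :=
            hUcongr _ _ γ fun β hβ => by simp only [Function.update_of_ne hβ.ne]
          rw [hE, hUu]
          simpa using hq'g)
    exact ⟨fun x => (f x).2, (f γ).1, (hf γ).2.2, (hf γ).1⟩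
  obtain ⟨ψ⟩ := IsDenseEmb.nonempty_orderIso (e := fun s : SuccTree Θ Λ => E s.fn s.ix) (by
    refine ⟨?_, ?_, ?_⟩
    · rintro s t ⟨h₁, h₂⟩
      exact (hEle s.fn _ _ h₁).trans_eq (hEcongr _ _ _ h₂)
    · intro s t
      wlog hst : s.ix ≤ t.ix generalizing s t with H
      · intro h
        exact (H t s (le_of_not_ge hst) h.symm).symm
      intro h
      exact ⟨t, ⟨hst, fun x hx => (hinc _ _ _ _ h hst x hx).symm⟩, le_rfl⟩
    · intro p
      -- A node of level `c p` compatible with `r p` must lie below it, since that level decides the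
      -- antichain containing `r p`.
      obtain ⟨s, hs⟩ := hpre (r p) (c p)
      refine ⟨⟨c p, s⟩, le_trans ?_ (hr p)⟩
      change E s (c p) ≤ r p
      rw [hE] at hs ⊢
      exact (hG _ _ (hmain s _).1).2.2.2 _ _ ⟨p, rfl, rfl⟩ hs)
  exact ⟨ψ.symm⟩

theorem nonempty_ro_col {P : Type u} [Preorder P] [Nonempty P] (θ lam : Cardinal.{u})
    (hθ : ℵ₀ ≤ θ) (hlam : lam ≠ 0) (hP : #P ≤ lam)
    (hclosed : ∀ (γ : θ.ord.ToType) (f : θ.ord.ToType → P),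
      (∀ β β', β ≤ β' → β' < γ → f β' ≤ f β) → ∃ p, ∀ β < γ, p ≤ f β)
    (hanti : ∀ p : P, ∃ g : lam.ord.ToType → P,
      (∀ a, g a ≤ p) ∧ ∀ a b, a ≠ b → ¬ Compat (g a) (g b))
    (c : P → θ.ord.ToType) (r : P → P) (hr : ∀ p, r p ≤ p)
    (hcr : ∀ p q, p ≠ q → c p = c q → ¬ Compat (r p) (r q)) :
    Nonempty (RO P ≃o RO (CollTree θ lam)) := by
  obtain ⟨φ⟩ := nonempty_succTree_collTree θ lam hθ hlam
  have hne : Nonempty lam.ord.ToType := by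
    rw [← mk_ne_zero_iff]
    simpa using hlam
  obtain ⟨ψ⟩ := nonempty_ro_succTree (by simpa using hP) hclosed hanti c r hr hcr
  exact ⟨ψ.trans φ⟩

/-! ### Cardinality tools -/

theorem exists_linearOrder_mk_Iio_lt (ι : Type u) :
    ∃ (_ : LinearOrder ι) (_ : WellFoundedLT ι), ∀ a : ι, #(Set.Iio a) < #ι := by
  obtain ⟨h₁, h₂, h⟩ := exists_ord_eq_type_lt ι
  exact ⟨h₁, h₂, fun a => mk_Iio_lt a h⟩

theorem mk_Iio_toType_lt {c : Cardinal.{u}} (i : c.ord.ToType) : #(Set.Iio i) < c := by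
  simpa using mk_Iio_lt i

theorem mk_Iic_toType_lt {c : Cardinal.{u}} (hc : ℵ₀ ≤ c) (i : c.ord.ToType) :
    #(Set.Iic i) < c := by
  have := Cardinal.noMaxOrder hc
  obtain ⟨j, hj⟩ := exists_gt i
  exact (mk_le_mk_of_subset fun x (hx : x ≤ i) => hx.trans_lt hj).trans_lt (mk_Iio_toType_lt j)

theorem le_mk_sdiff {α : Type u} {ν : Cardinal.{u}} (hν : ℵ₀ ≤ ν) {A B : Set α} (hA : ν ≤ #A)
    (hB : #B < ν) : ν ≤ #(A \ B : Set α) := by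
  by_contra! h
  refine (add_lt_of_lt hν h hB).not_ge (hA.trans (le_trans ?_ (mk_union_le _ _)))
  exact mk_le_mk_of_subset fun x hx => by
    by_cases hxB : x ∈ B
    · exact Or.inr hxB
    · exact Or.inl ⟨hx, hxB⟩

theorem nonempty_of_le_mk {α : Type u} {ν : Cardinal.{u}} (hν : ℵ₀ ≤ ν) {A : Set α}
    (hA : ν ≤ #A) : A.Nonempty := by
  rw [Set.nonempty_iff_ne_empty]
  rintro rfl
  simp only [mk_eq_zero, nonpos_iff_eq_zero] at hA
  exact (aleph0_pos.trans_le hν).ne' hA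

theorem mk_biUnion_lt {ι α : Type u} {ν : Cardinal.{u}} (hν : ν.IsRegular) {s : Set ι}
    (hs : #s < ν) {t : ι → Set α} (ht : ∀ i ∈ s, #(t i) < ν) :
    #(⋃ i ∈ s, t i : Set α) < ν :=
  (card_biUnion_lt_iff_forall_of_isRegular hν hs).2 ht

theorem mk_iUnion_nat_lt {α : Type u} {ν : Cardinal.{u}} (hν : ν.IsRegular) (h₀ : ℵ₀ < ν)
    {t : ℕ → Set α} (ht : ∀ n, #(t n) < ν) : #(⋃ n, t n : Set α) < ν := by
  have h := (card_iUnion_lt_iff_forall_of_isRegular (ι := ULift.{u} ℕ)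
    (t := fun n => t n.down) hν (by simpa using h₀)).2 fun n => ht n.down
  refine lt_of_le_of_lt (mk_le_mk_of_subset ?_) h
  exact Set.iUnion_subset fun n => Set.subset_iUnion (fun n : ULift.{u} ℕ => t n.down) ⟨n⟩

/-- A set that meets exactly `ν` many members of an almost disjoint family in large sets has a
large subset that is almost disjoint from all these members. -/
theorem exists_almost_disjoint {X : Type u} {ν : Cardinal.{u}} (hν : ν.IsRegular)
    {W : Set (Set X)} (hW : #W = ν) (hAD : ∀ A ∈ W, ∀ B ∈ W, A ≠ B → #(A ∩ B : Set X) < ν)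
    {p : Set X} (hp : ∀ B ∈ W, ν ≤ #(B ∩ p : Set X)) :
    ∃ q ⊆ p, ν ≤ #q ∧ ∀ B ∈ W, #(B ∩ q : Set X) < ν := by
  obtain ⟨e⟩ : Nonempty (ν.ord.ToType ≃ W) := Cardinal.eq.1 (by simpa using hW.symm)
  have hω := hν.aleph0_le
  have hne : Nonempty X := by
    have : Nonempty W := by
      rw [← mk_ne_zero_iff, hW]
      exact hν.pos.ne'
    obtain ⟨B⟩ := this
    obtain ⟨x, -⟩ := nonempty_of_le_mk hω (hp B B.2)
    exact ⟨x⟩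
  -- Diagonalization: the `i`-th point lies in the `i`-th member and outside all earlier ones, so
  -- each member catches only an initial part of the sequence. Regularity keeps the union of the
  -- earlier overlaps small.
  obtain ⟨b, hb⟩ := exists_transfinite_rel (ι := ν.ord.ToType) (Z := X)
    (fun i z => z ∈ (e i : Set X) ∩ p ∧ ∀ j < i, z ∉ (e j : Set X)) (fun _ _ y z => y ≠ z) (by
      intro i g
      have h₁ : #(⋃ j ∈ Set.Iio i, ((e j : Set X) ∩ e i : Set X)) < ν :=
        mk_biUnion_lt hν (mk_Iio_toType_lt i) fun j hj =>
          hAD _ (e j).2 _ (e i).2 fun h => (ne_of_lt hj) (e.injective (Subtype.ext h))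
      have h₂ : #(g '' Set.Iio i) < ν := mk_image_le.trans_lt (mk_Iio_toType_lt i)
      obtain ⟨z, ⟨hz, hz₁⟩, hz₂⟩ := nonempty_of_le_mk hω
        (le_mk_sdiff hω (le_mk_sdiff hω (hp _ (e i).2) h₁) h₂)
      refine ⟨z, ⟨hz, fun j hj hzj => hz₁ ?_⟩, fun j hj h => hz₂ ⟨j, hj, h⟩⟩
      exact Set.mem_biUnion (show j ∈ Set.Iio i from hj) ⟨hzj, hz.1⟩)
  have hinj : Function.Injective b := by
    intro i j hij
    rcases lt_trichotomy i j with h | h | h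
    · exact absurd hij ((hb j).2 i h)
    · exact h
    · exact absurd hij.symm ((hb i).2 j h)
  refine ⟨Set.range b, ?_, ?_, ?_⟩
  · rintro _ ⟨i, rfl⟩
    exact (hb i).1.1.2
  · rw [mk_range_eq b hinj]
    simp
  · intro B hB
    obtain ⟨j, hj⟩ := e.surjective ⟨B, hB⟩
    refine lt_of_le_of_lt ((mk_le_mk_of_subset ?_).trans (mk_image_le (f := b)))
      (mk_Iic_toType_lt hω j)
    rintro _ ⟨hxB, i, rfl⟩
    refine ⟨i, not_lt.1 fun hji => (hb i).1.2 j hji ?_, rfl⟩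
    rwa [hj]

/-! ### Refining almost disjoint families -/

/-- An injective function on a large set lies strictly above an injective function on a large
subset. -/
theorem exists_injOn_lt {X : Type u} {ν : Cardinal.{u}} (hν : ℵ₀ ≤ ν) {C : Set X}
    (hC : ν ≤ #C) {φ : X → ν.ord.ToType} (hφ : Set.InjOn φ C) :
    ∃ (D : Set X) (ψ : X → ν.ord.ToType), D ⊆ C ∧ ν ≤ #D ∧ Set.InjOn ψ D ∧
      ∀ x ∈ D, ψ x < φ x := by
  have hne : Nonempty X := ⟨(nonempty_of_le_mk hν hC).some⟩
  -- The points satisfy `i < φ (b i)`, so the inverse of `b` serves as the smaller injective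
  -- function.
  obtain ⟨b, hb⟩ := exists_transfinite_rel (ι := ν.ord.ToType) (Z := X)
    (fun i z => z ∈ C ∧ i < φ z) (fun _ _ y z => y ≠ z) (by
      intro i g
      have h₁ : #({z | z ∈ C ∧ φ z ≤ i} : Set X) < ν := by
        refine lt_of_le_of_lt ?_ (mk_Iic_toType_lt hν i)
        refine mk_le_of_injective (f := fun z => ⟨φ z, z.2.2⟩) fun y z h => ?_
        exact Subtype.ext (hφ y.2.1 z.2.1 (congrArg Subtype.val h))
      have h₂ : #(g '' Set.Iio i) < ν := mk_image_le.trans_lt (mk_Iio_toType_lt i)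
      obtain ⟨z, ⟨hz, hz₁⟩, hz₂⟩ := nonempty_of_le_mk hν
        (le_mk_sdiff hν (le_mk_sdiff hν hC h₁) h₂)
      exact ⟨z, ⟨hz, not_le.1 fun h => hz₁ ⟨hz, h⟩⟩, fun j hj h => hz₂ ⟨j, hj, h⟩⟩)
  have hinj : Function.Injective b := by
    intro i j hij
    rcases lt_trichotomy i j with h | h | h
    · exact absurd hij ((hb j).2 i h)
    · exact h
    · exact absurd hij.symm ((hb i).2 j h)
  have : Nonempty ν.ord.ToType := ⟨φ hne.some⟩
  have hinv : ∀ i, Function.invFun b (b i) = i := Function.leftInverse_invFun hinj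
  refine ⟨Set.range b, Function.invFun b, ?_, ?_, ?_, ?_⟩
  · rintro _ ⟨i, rfl⟩
    exact (hb i).1.1
  · rw [mk_range_eq b hinj]
    simp
  · rintro _ ⟨i, rfl⟩ _ ⟨j, rfl⟩ h
    rw [hinv, hinv] at h
    rw [h]
  · rintro _ ⟨i, rfl⟩
    rw [hinv]
    exact (hb i).1.2

/-- A large set with an injective function into the initial ordinal of `ν`. -/
def IsRanked {X : Type u} (ν : Cardinal.{u}) (z : Set X × (X → ν.ord.ToType)) : Prop :=
  ν ≤ #z.1 ∧ Set.InjOn z.2 z.1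

/-- A maximal almost disjoint family of ranked sets. -/
structure IsRankedMAD {X : Type u} (ν : Cardinal.{u}) (F : Set (Set X × (X → ν.ord.ToType))) :
    Prop where
  ranked : ∀ z ∈ F, IsRanked ν z
  ad : ∀ y ∈ F, ∀ z ∈ F, y ≠ z → #(y.1 ∩ z.1 : Set X) < ν
  predense : ∀ p : Set X, ν ≤ #p → ∃ z ∈ F, ν ≤ #(z.1 ∩ p : Set X)

/-- A maximal almost disjoint subfamily of `S` is predense, since any large set missed by it would
contain a further member of `S`. -/
theorem exists_isRankedMAD {X : Type u} {ν : Cardinal.{u}}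
    (S : Set (Set X × (X → ν.ord.ToType))) (hS : ∀ z ∈ S, IsRanked ν z)
    (hdense : ∀ p : Set X, ν ≤ #p → ∃ z ∈ S, z.1 ⊆ p) :
    ∃ F ⊆ S, IsRankedMAD ν F := by
  obtain ⟨F, -, hFS, hFp, hmax⟩ := exists_maximal_pairwise
    (fun y z : Set X × (X → ν.ord.ToType) => #(y.1 ∩ z.1 : Set X) < ν) S ∅
    (Set.empty_subset S) (Set.pairwise_empty _)
  refine ⟨F, hFS, fun z hz => hS z (hFS hz), fun y hy z hz hne => hFp hy hz hne, ?_⟩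
  intro p hp
  obtain ⟨z, hz, hzp⟩ := hdense p hp
  by_cases hzF : z ∈ F
  · refine ⟨z, hzF, ?_⟩
    rw [Set.inter_eq_left.2 hzp]
    exact (hS z hz).1
  · obtain ⟨y, hy, -, hyz⟩ := hmax z hz hzF
    refine ⟨y, hy, ?_⟩
    rw [Set.inter_comm z.1 y.1, and_self, not_lt] at hyz
    exact hyz.trans (mk_le_mk_of_subset (Set.inter_subset_inter_right _ hzp))

theorem exists_isRankedMAD_zero (X : Type u) {ν : Cardinal.{u}} (hν : ℵ₀ ≤ ν) :
    ∃ F : Set (Set X × (X → ν.ord.ToType)), IsRankedMAD ν F := by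
  classical
  obtain ⟨F, -, hF⟩ := exists_isRankedMAD (X := X) {z | IsRanked ν z} (fun z hz => hz) (by
    intro p hp
    obtain ⟨q, hqp, hq⟩ := le_mk_iff_exists_subset.1 hp
    obtain ⟨e⟩ : Nonempty (q ≃ ν.ord.ToType) := Cardinal.eq.1 (by simpa using hq)
    obtain ⟨x₀, hx₀⟩ := nonempty_of_le_mk hν hq.ge
    refine ⟨(q, fun x => if h : x ∈ q then e ⟨x, h⟩ else e ⟨x₀, hx₀⟩), ⟨hq.ge, ?_⟩, hqp⟩
    intro x hx y hy hxy
    have hx : x ∈ q := hx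
    have hy : y ∈ q := hy
    simp only [hx, hy, dite_true] at hxy
    exact congrArg Subtype.val (e.injective hxy))
  exact ⟨F, hF⟩

theorem IsRankedMAD.exists_refinement {X : Type u} {ν : Cardinal.{u}} (hν : ℵ₀ ≤ ν)
    {F : Set (Set X × (X → ν.ord.ToType))} (hF : IsRankedMAD ν F) :
    ∃ G : Set (Set X × (X → ν.ord.ToType)), IsRankedMAD ν G ∧
      ∀ z ∈ G, ∃ y ∈ F, z.1 ⊆ y.1 ∧ ∀ x ∈ z.1, z.2 x < y.2 x := by
  obtain ⟨G, hGS, hG⟩ := exists_isRankedMAD (X := X)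
    {z | IsRanked ν z ∧ ∃ y ∈ F, z.1 ⊆ y.1 ∧ ∀ x ∈ z.1, z.2 x < y.2 x} (fun z hz => hz.1) (by
    intro p hp
    obtain ⟨y, hy, hyp⟩ := hF.predense p hp
    obtain ⟨D, ψ, hD, hDν, hψ, hlt⟩ := exists_injOn_lt hν hyp
      ((hF.ranked y hy).2.mono Set.inter_subset_left)
    exact ⟨(D, ψ), ⟨⟨hDν, hψ⟩, y, hy, hD.trans Set.inter_subset_left, hlt⟩,
      hD.trans Set.inter_subset_right⟩)
  exact ⟨G, hG, fun z hz => (hGS hz).2⟩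

/-- For regular uncountable `ν` there are countably many almost disjoint families such that every
set of size `ν` meets more than `ν` many members of one of them in sets of size `ν`. -/
theorem exists_families (X : Type u) {ν : Cardinal.{u}} (hν : ν.IsRegular) (h₀ : ℵ₀ < ν) :
    ∃ 𝒜 : ℕ → Set (Set X), (∀ n, ∀ A ∈ 𝒜 n, ∀ B ∈ 𝒜 n, A ≠ B → #(A ∩ B : Set X) < ν) ∧
      ∀ p : Set X, ν ≤ #p → ∃ n, ν < #{B | B ∈ 𝒜 n ∧ ν ≤ #(B ∩ p : Set X)} := by
  obtain ⟨F, hF, href⟩ : ∃ F : ℕ → Set (Set X × (X → ν.ord.ToType)), (∀ n, IsRankedMAD ν (F n)) ∧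
      ∀ n, ∀ z ∈ F (n + 1), ∃ y ∈ F n, z.1 ⊆ y.1 ∧ ∀ x ∈ z.1, z.2 x < y.2 x := by
    obtain ⟨F₀, hF₀⟩ := exists_isRankedMAD_zero X h₀.le
    have step : ∀ F : {F : Set (Set X × (X → ν.ord.ToType)) // IsRankedMAD ν F},
        ∃ G : {F : Set (Set X × (X → ν.ord.ToType)) // IsRankedMAD ν F},
          ∀ z ∈ G.1, ∃ y ∈ F.1, z.1 ⊆ y.1 ∧ ∀ x ∈ z.1, z.2 x < y.2 x := by
      intro F
      obtain ⟨G, hG, h⟩ := F.2.exists_refinement h₀.le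
      exact ⟨⟨G, hG⟩, h⟩
    choose G hG using step
    let F : ℕ → {F : Set (Set X × (X → ν.ord.ToType)) // IsRankedMAD ν F} :=
      fun n => Nat.rec ⟨F₀, hF₀⟩ (fun _ F => G F) n
    exact ⟨fun n => (F n).1, fun n => (F n).2, fun n => hG (F n)⟩
  have hAD : ∀ n, ∀ A ∈ Prod.fst '' F n, ∀ B ∈ Prod.fst '' F n, A ≠ B →
      #(A ∩ B : Set X) < ν := by
    rintro n _ ⟨y, hy, rfl⟩ _ ⟨z, hz, rfl⟩ hne
    exact (hF n).ad y hy z hz fun h => hne (h ▸ rfl)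
  refine ⟨fun n => Prod.fst '' F n, hAD, fun p hp => ?_⟩
  by_contra! hsmall
  have hω := h₀.le
  let W : ℕ → Set (Set X) := fun n => {B | B ∈ Prod.fst '' F n ∧ ν ≤ #(B ∩ p : Set X)}
  -- Exactly `ν` members is impossible: diagonalizing against them gives a large subset of `p` that
  -- no member of the maximal family meets in a large set.
  have hWlt : ∀ n, #(W n) < ν := by
    intro n
    refine lt_of_le_of_ne (hsmall n) fun hW => ?_
    obtain ⟨q, hqp, hq, hqW⟩ := exists_almost_disjoint hν hW
      (fun A hA B hB => hAD n A hA.1 B hB.1) fun B hB => hB.2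
    obtain ⟨z, hz, hzq⟩ := (hF n).predense q hq
    refine (hqW z.1 ⟨⟨z, hz, rfl⟩, ?_⟩).not_ge hzq
    exact hzq.trans (mk_le_mk_of_subset (Set.inter_subset_inter_right _ hqp))
  have hcov : ∀ n, #(p \ ⋃ B ∈ W n, B : Set X) < ν := by
    intro n
    by_contra! hq
    obtain ⟨z, hz, hzq⟩ := (hF n).predense _ hq
    obtain ⟨x, hx, hxp, hxW⟩ := nonempty_of_le_mk hω hzq
    refine hxW (Set.mem_biUnion (show z.1 ∈ W n from ⟨⟨z, hz, rfl⟩, ?_⟩) hx)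
    exact hzq.trans (mk_le_mk_of_subset (Set.inter_subset_inter_right _ Set.sdiff_subset))
  have hov : ∀ n, #(⋃ A ∈ W n, ⋃ B ∈ W n \ {A}, (A ∩ B : Set X) : Set X) < ν := by
    intro n
    refine mk_biUnion_lt hν (hWlt n) fun A hA => mk_biUnion_lt hν
      ((mk_le_mk_of_subset Set.sdiff_subset).trans_lt (hWlt n)) fun B hB => ?_
    exact hAD n A hA.1 B hB.1.1 fun h => hB.2 h.symm
  -- As `ν` is regular and uncountable, some `x` in `p` avoids all exceptional sets: for every `n`
  -- it lies in exactly one member of `W n`. Its ranks along these members would decrease forever.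
  obtain ⟨x, ⟨hxp, hx₁⟩, hx₂⟩ := nonempty_of_le_mk hω (le_mk_sdiff hω (le_mk_sdiff hω hp
    (mk_iUnion_nat_lt hν h₀ hcov)) (mk_iUnion_nat_lt hν h₀ hov))
  have hex : ∀ n, ∃ z ∈ F n, x ∈ z.1 ∧ z.1 ∈ W n := by
    intro n
    by_contra! hcon
    refine hx₁ (Set.mem_iUnion.2 ⟨n, hxp, fun h => ?_⟩)
    obtain ⟨B, hB, hxB⟩ := Set.mem_iUnion₂.1 h
    obtain ⟨z, hz, rfl⟩ := hB.1
    exact hcon z hz hxB hB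
  choose z hzF hxz hzW using hex
  have hdesc : ∀ n, (z (n + 1)).2 x < (z n).2 x := by
    intro n
    obtain ⟨y, hy, hsub, hlt⟩ := href n (z (n + 1)) (hzF (n + 1))
    have hyW : y.1 ∈ W n := ⟨⟨y, hy, rfl⟩, (hzW (n + 1)).2.trans
      (mk_le_mk_of_subset (Set.inter_subset_inter_left _ hsub))⟩
    have hyz : y = z n := by
      by_contra hne
      have hne' : y.1 ≠ (z n).1 := fun h => by
        have h₁ := (hF n).ad y hy (z n) (hzF n) hne
        rw [← h, Set.inter_self] at h₁
        exact h₁.not_ge ((hF n).ranked y hy).1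
      exact hx₂ (Set.mem_iUnion.2 ⟨n, Set.mem_iUnion₂.2 ⟨y.1, hyW, Set.mem_iUnion₂.2
        ⟨(z n).1, ⟨hzW n, fun h => hne' h.symm⟩, hsub (hxz _), hxz n⟩⟩⟩)
    rw [← hyz]
    exact hlt x (hxz (n + 1))
  exact (RelEmbedding.natGT (r := (· < ·)) (fun n => (z n).2 x) hdesc).not_wellFounded
    wellFounded_lt

/-! ### Almost disjoint refinements -/

/-- Every system of at most `κ⁺` large subsets of a set of size `κ` has a refinement whose index
set can be coloured by `C` so that sets of the same colour are almost disjoint. -/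
def HasRefinement (κ : Cardinal.{u}) (C : Type u) : Prop :=
  ∀ (X ι : Type u), #X = κ → #ι ≤ Order.succ κ → ∀ p : ι → Set X, (∀ a, κ ≤ #(p a)) →
    ∃ (c : ι → C) (r : ι → Set X), (∀ a, r a ⊆ p a ∧ κ ≤ #(r a)) ∧
      ∀ a b, a ≠ b → c a = c b → #(r a ∩ r b : Set X) < κ

/-- The colour is the index of a family with more than `κ` members meeting `p a` in large sets. Only
at most `κ` members are taken at earlier stages, so a new one is always available. -/
theorem hasRefinement_of_isRegular {κ : Cardinal.{u}} (hκ : κ.IsRegular) (h₀ : ℵ₀ < κ) :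
    HasRefinement κ (ULift.{u} ℕ) := by
  intro X ι _ hι p hp
  obtain ⟨𝒜, hAD, h𝒜⟩ := exists_families X hκ h₀
  choose n hn using fun a => h𝒜 (p a) (hp a)
  obtain ⟨_, _, hIio⟩ := exists_linearOrder_mk_Iio_lt ι
  obtain ⟨f, hf⟩ := exists_transfinite_rel (ι := ι) (Z := Set X)
    (fun a B => B ∈ 𝒜 (n a) ∧ κ ≤ #(B ∩ p a : Set X)) (fun _ _ y z => y ≠ z) (by
      intro a g
      have h : #(g '' Set.Iio a) < #{B | B ∈ 𝒜 (n a) ∧ κ ≤ #(B ∩ p a : Set X)} :=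
        (mk_image_le.trans (Order.lt_succ_iff.1 ((hIio a).trans_le hι))).trans_lt (hn a)
      obtain ⟨B, hB, hBg⟩ := sdiff_nonempty_of_mk_lt_mk h
      exact ⟨B, hB, fun b hb h => hBg ⟨b, hb, h⟩⟩)
  refine ⟨fun a => ⟨n a⟩, fun a => f a ∩ p a, fun a => ⟨Set.inter_subset_right, (hf a).1.2⟩, ?_⟩
  intro a b hab hc
  have hc' : n a = n b := congrArg ULift.down hc
  have hne : f a ≠ f b := by
    rcases hab.lt_or_gt with h | h
    · exact (hf b).2 a h
    · exact ((hf a).2 b h).symm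
  refine (mk_le_mk_of_subset ?_).trans_lt
    (hAD (n b) (f a) (hc' ▸ (hf a).1.1) (f b) (hf b).1.1 hne)
  exact fun x hx => ⟨hx.1.1, hx.2.1⟩

/-- A small subset of the initial ordinal of a cofinality is bounded. -/
theorem exists_bound {κ : Cardinal.{u}} (t : Set κ.ord.cof.ord.ToType) (ht : #t < κ.ord.cof) :
    ∃ i, ∀ m ∈ t, m < i := by
  by_contra! h
  have hcof : Order.cof κ.ord.cof.ord.ToType ≤ #t := Order.cof_le fun i => h i
  rw [Ordinal.cof_toType, Ordinal.cof_ord_cof] at hcof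
  exact ht.not_ge hcof

/-- A set of size `κ` is a union of `cf κ` many small sets. -/
theorem exists_small_fibers {X : Type u} {κ : Cardinal.{u}} (hκ : ℵ₀ ≤ κ) (hX : #X = κ) :
    ∃ h : X → κ.ord.cof.ord.ToType, ∀ i, #{x | h x ≤ i} < κ := by
  obtain ⟨e⟩ : Nonempty (X ≃ κ.ord.ToType) := Cardinal.eq.1 (by simpa using hX)
  obtain ⟨s, hs, hs'⟩ := Order.exists_cof_eq κ.ord.ToType
  rw [Ordinal.cof_toType] at hs'
  obtain ⟨f⟩ : Nonempty (s ≃ κ.ord.cof.ord.ToType) := Cardinal.eq.1 (by simpa using hs')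
  choose m hm hle using hs
  refine ⟨fun x => f ⟨m (e x), hm (e x)⟩, fun i => ?_⟩
  have hreg : κ.ord.cof.IsRegular := isRegular_cof (isSuccLimit_ord hκ)
  let t : Set κ.ord.ToType := (fun j => (f.symm j : κ.ord.ToType)) '' Set.Iic i
  have ht : #t < κ.ord.cof := mk_image_le.trans_lt (mk_Iic_toType_lt hreg.aleph0_le i)
  obtain ⟨y, hy⟩ : ∃ y, ∀ z ∈ t, z < y := by
    by_contra! h
    have hcof : Order.cof κ.ord.ToType ≤ #t := Order.cof_le fun i => h i
    rw [Ordinal.cof_toType] at hcof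
    exact ht.not_ge hcof
  refine lt_of_le_of_lt ?_ (mk_Iio_toType_lt y)
  refine mk_le_of_injective (f := fun x => ⟨e x, ?_⟩) fun x x' h => ?_
  · refine (hle (e x)).trans_lt (hy _ ⟨_, x.2, ?_⟩)
    simp
  · exact Subtype.ext (e.injective (congrArg Subtype.val h))

/-- The possible shapes of large sets at a singular cardinal: an injective sequence of indices of
fibers, and a sequence of levels. -/
abbrev Shape (M : Type u) : Type u := {j : M → M // Function.Injective j} × (M → ℕ)

theorem mk_shape_le {μ : Cardinal.{u}} (hμ : ℵ₀ ≤ μ) : #(Shape μ.ord.ToType) ≤ 2 ^ μ := by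
  have h₁ : #{j : μ.ord.ToType → μ.ord.ToType // Function.Injective j} ≤ 2 ^ μ := by
    refine (mk_subtype_le _).trans ?_
    simp [power_self_eq hμ]
  have h₂ : #(μ.ord.ToType → ℕ) ≤ 2 ^ μ := by
    rw [← power_self_eq hμ]
    simpa using power_le_power_right hμ
  rw [mk_prod, lift_id, lift_id]
  refine (mul_le_mul' h₁ h₂).trans (mul_eq_self ?_).le
  exact hμ.trans (cantor μ).le

/-- Each large set is recorded by a shape, and `t` thins out the fibers it uses. Sets of equal shape
are separated inside the fibers, up to boundedly many; sets of different shape but equal colour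
share few fibers. -/
theorem hasRefinement_of_cof_lt {κ : Cardinal.{u}} (hκ : ℵ₀ ≤ κ) (hcof : κ.ord.cof < κ)
    {C : Type u} (hT : ∃ (c : Shape κ.ord.cof.ord.ToType → C)
      (t : Shape κ.ord.cof.ord.ToType → Set κ.ord.cof.ord.ToType),
      (∀ σ, t σ ⊆ Set.range σ.1.1 ∧ κ.ord.cof ≤ #(t σ)) ∧
      ∀ σ τ, σ ≠ τ → c σ = c τ → #(t σ ∩ t τ : Set _) < κ.ord.cof) :
    HasRefinement κ C := by
  intro X ι hX hι p hp
  obtain ⟨c, t, ht, htAD⟩ := hT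
  obtain ⟨h, hh⟩ := exists_small_fibers hκ hX
  have hμreg : κ.ord.cof.IsRegular := isRegular_cof (isSuccLimit_ord hκ)
  have hμω := hμreg.aleph0_le
  have hbdd : ∀ s : Set κ.ord.cof.ord.ToType, #s < κ.ord.cof → #{x | h x ∈ s} < κ := by
    intro s hs
    obtain ⟨i, hi⟩ := exists_bound s hs
    have hsub : {x | h x ∈ s} ⊆ {x | h x ≤ i} := fun x hx => (hi _ hx).le
    exact (mk_le_mk_of_subset hsub).trans_lt (hh i)
  have hne : Nonempty κ.ord.cof.ord.ToType := by
    rw [← mk_ne_zero_iff]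
    simpa using hμreg.pos.ne'
  obtain ⟨ρ, hρ⟩ : ∃ ρ : κ.ord.cof.ord.ToType → Cardinal.{u},
      ∀ i, ρ i = max #{x | h x ≤ i} κ.ord.cof := ⟨_, fun _ => rfl⟩
  have hρκ : ∀ i, ρ i < κ := fun i => by
    rw [hρ]
    exact max_lt (hh i) hcof
  have hρω : ∀ i, ℵ₀ ≤ ρ i := fun i => by
    rw [hρ]
    exact hμω.trans (le_max_right _ _)
  have hρmono : ∀ i j, i ≤ j → ρ i ≤ ρ j := fun i j hij => by
    rw [hρ, hρ]
    exact max_le_max_right _ (mk_le_mk_of_subset fun x (hx : h x ≤ i) => hx.trans hij)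
  have hρsup : ∀ d < κ, ∃ i, d ≤ ρ i := by
    intro d hd
    by_contra! hcon
    have h₁ : #X ≤ κ.ord.cof * max d κ.ord.cof := by
      have huniv : (⋃ i, {x | h x ≤ i}) = Set.univ :=
        Set.eq_univ_of_forall fun x => Set.mem_iUnion.2 ⟨h x, le_refl (h x)⟩
      rw [← mk_univ, ← huniv]
      refine (mk_iUnion_le _).trans (mul_le_mul' (by simp) (ciSup_le' fun i => ?_))
      exact (le_max_left _ κ.ord.cof).trans (((hρ i).symm.le.trans (hcon i).le).trans
        (le_max_left _ _))
    rw [hX] at h₁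
    exact h₁.not_gt (mul_lt_of_lt hκ hcof (max_lt hd hcof))
  obtain ⟨ν, hν⟩ : ∃ ν : κ.ord.cof.ord.ToType → Cardinal.{u}, ∀ i, ν i = Order.succ (ρ i) :=
    ⟨_, fun _ => rfl⟩
  have hνreg : ∀ i, (ν i).IsRegular := fun i => hν i ▸ isRegular_succ (hρω i)
  have hρν : ∀ i, ρ i < ν i := fun i => hν i ▸ Order.lt_succ (ρ i)
  have hν₀ : ∀ i, ℵ₀ < ν i := fun i => (hρω i).trans_lt (hρν i)
  -- A successor of an infinite cardinal is regular, whereas `κ` is singular.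
  have hνκ : ∀ i, ν i < κ := by
    intro i
    refine lt_of_le_of_ne (hν i ▸ Order.succ_le_of_lt (hρκ i)) fun heq => ?_
    have := (hνreg i).cof_ord
    rw [heq] at this
    exact hcof.ne this
  choose 𝒜 h𝒜AD h𝒜 using fun i => exists_families X (hνreg i) (hν₀ i)
  have hj : ∀ a, ∃ j : κ.ord.cof.ord.ToType → κ.ord.cof.ord.ToType,
      ∀ i, ν i ≤ #(p a ∩ h ⁻¹' {j i} : Set X) ∧ ∀ i' < i, j i' ≠ j i := by
    intro a
    refine exists_transfinite_rel (fun i z => ν i ≤ #(p a ∩ h ⁻¹' {z} : Set X))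
      (fun _ _ y z => y ≠ z) fun i g => ?_
    by_contra! hcon
    have hsub : p a ⊆ {x | h x ∈ g '' Set.Iio i} ∪
        ⋃ z ∈ (g '' Set.Iio i)ᶜ, (p a ∩ h ⁻¹' {z}) := by
      intro x hx
      by_cases hxg : h x ∈ g '' Set.Iio i
      · exact Or.inl hxg
      · exact Or.inr (Set.mem_biUnion hxg ⟨hx, rfl⟩)
    have h₂ : #(⋃ z ∈ (g '' Set.Iio i)ᶜ, (p a ∩ h ⁻¹' {z}) : Set X) < κ := by
      refine lt_of_le_of_lt ((mk_biUnion_le _ _).trans (mul_le_mul'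
        ((mk_set_le _).trans_eq (mk_ord_toType _)) (ciSup_le' fun z => ?_)))
        (mul_lt_of_lt hκ hcof (hνκ i))
      by_contra! hlt
      obtain ⟨b, hb, hgb⟩ := hcon z hlt.le
      exact z.2 ⟨b, hb, hgb⟩
    exact ((hp a).trans ((mk_le_mk_of_subset hsub).trans (mk_union_le _ _))).not_gt
      (add_lt_of_lt hκ (hbdd _ (mk_image_le.trans_lt (mk_Iio_toType_lt i))) h₂)
  choose j hj using hj
  have hjinj : ∀ a, Function.Injective (j a) := by
    intro a i i' hii
    rcases lt_trichotomy i i' with hlt | hlt | hlt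
    · exact absurd hii ((hj a i').2 i hlt)
    · exact hlt
    · exact absurd hii.symm ((hj a i).2 i' hlt)
  choose n hn using fun a i => h𝒜 i (p a ∩ h ⁻¹' {j a i}) (hj a i).1
  let τ : ι → Shape κ.ord.cof.ord.ToType := fun a => (⟨j a, hjinj a⟩, n a)
  have hτj : ∀ a b, τ a = τ b → j a = j b := fun a b hab =>
    congrArg (fun σ : Shape κ.ord.cof.ord.ToType => σ.1.1) hab
  have hτn : ∀ a b, τ a = τ b → n a = n b := fun a b hab => congrArg Prod.snd hab
  obtain ⟨_, _, hIio⟩ := exists_linearOrder_mk_Iio_lt ι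
  have hε : ∀ a : ι, Nonempty (Set.Iio a ↪ X) := fun a =>
    Cardinal.le_def _ _ |>.1 (hX ▸ Order.lt_succ_iff.1 ((hIio a).trans_le hι))
  let ε := fun a => (hε a).some
  -- The at most `κ` predecessors of `a` are embedded in `X`; at coordinate `i` only those landing
  -- in the first fibers must be avoided. There are at most `ρ i` of them, and each predecessor is
  -- treated from some coordinate on.
  let N : ι → κ.ord.cof.ord.ToType → Set ι := fun a i =>
    {b | ∃ hb : b < a, h (ε a ⟨b, hb⟩) ≤ i}
  have hN : ∀ a i, #(N a i) ≤ ρ i := by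
    intro a i
    rw [hρ]
    refine le_trans ?_ (le_max_left _ _)
    refine mk_le_of_injective (f := fun b => ⟨ε a ⟨b, b.2.1⟩, b.2.2⟩) fun b b' hbb => ?_
    exact Subtype.ext (congrArg (fun y : Set.Iio a => (y : ι))
      ((ε a).injective (congrArg Subtype.val hbb)))
  obtain ⟨f, hf⟩ := exists_transfinite_rel (ι := ι) (Z := κ.ord.cof.ord.ToType → Set X)
    (fun a z => ∀ i, z i ∈ 𝒜 i (n a i) ∧ ν i ≤ #(z i ∩ (p a ∩ h ⁻¹' {j a i}) : Set X))
    (fun b a y z => ∀ i, b ∈ N a i → y i ≠ z i) (by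
      intro a g
      have hex : ∀ i, ∃ B : Set X, (B ∈ 𝒜 i (n a i) ∧
          ν i ≤ #(B ∩ (p a ∩ h ⁻¹' {j a i}) : Set X)) ∧ ∀ b ∈ N a i, g b i ≠ B := by
        intro i
        have hlt : #((fun b => g b i) '' N a i) < #{B | B ∈ 𝒜 i (n a i) ∧
            ν i ≤ #(B ∩ (p a ∩ h ⁻¹' {j a i}) : Set X)} :=
          (mk_image_le.trans (hN a i)).trans_lt ((hρν i).trans (hn a i))
        obtain ⟨B, hB, hBg⟩ := sdiff_nonempty_of_mk_lt_mk hlt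
        exact ⟨B, hB, fun b hb h => hBg ⟨b, hb, h⟩⟩
      choose z hz hz' using hex
      exact ⟨z, hz, fun b _ i hb => hz' i b hb⟩)
  let V : ι → κ.ord.cof.ord.ToType → Set X := fun a i =>
    (f a i ∩ (p a ∩ h ⁻¹' {j a i})) \
      ⋃ b ∈ {b | b ∈ N a i ∧ τ b = τ a}, (f b i ∩ f a i)
  have hV : ∀ a i, ν i ≤ #(V a i) := by
    intro a i
    refine le_mk_sdiff (hν₀ i).le ((hf a).1 i).2 (mk_biUnion_lt (hνreg i) ?_ fun b hb => ?_)
    · exact ((mk_le_mk_of_subset fun b hb => hb.1).trans (hN a i)).trans_lt (hρν i)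
    · refine h𝒜AD i (n a i) _ ?_ _ ((hf a).1 i).1 ((hf a).2 b hb.1.1 i hb.1)
      rw [← hτn b a hb.2]
      exact ((hf b).1 i).1
  refine ⟨fun a => c (τ a), fun a => ⋃ i ∈ {i | j a i ∈ t (τ a)}, V a i, fun a => ⟨?_, ?_⟩, ?_⟩
  · exact Set.iUnion₂_subset fun i _ x hx => hx.1.2.1
  · by_contra! hlt
    obtain ⟨i, hi⟩ := hρsup _ hlt
    obtain ⟨i', hi't, hii'⟩ : ∃ i' ∈ {i | j a i ∈ t (τ a)}, i ≤ i' := by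
      by_contra! hcon
      have h₁ : t (τ a) ⊆ j a '' Set.Iio i := by
        intro m hm
        obtain ⟨i', rfl⟩ := (ht (τ a)).1 hm
        exact ⟨i', hcon i' hm, rfl⟩
      exact (((ht (τ a)).2.trans (mk_le_mk_of_subset h₁)).trans mk_image_le).not_gt
        (mk_Iio_toType_lt i)
    have h₁ : ν i' ≤ #(⋃ i ∈ {i | j a i ∈ t (τ a)}, V a i : Set X) :=
      (hV a i').trans (mk_le_mk_of_subset (Set.subset_biUnion_of_mem hi't))
    exact ((h₁.trans hi).trans (hρmono _ _ hii')).not_gt (hρν i')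
  · intro a b hab hc
    wlog hba : b < a generalizing a b with H
    · rw [Set.inter_comm]
      exact H b a hab.symm hc.symm (lt_of_le_of_ne (not_lt.1 hba) hab)
    by_cases hτ : τ a = τ b
    -- Equal shapes place a common point at one coordinate `i` for both sets. Once `b ∈ N a i`, the
    -- overlap was removed from `V a i`, so the coordinates left are bounded.
    · have hsub : #(j a '' Set.Iio (h (ε a ⟨b, hba⟩))) < κ.ord.cof :=
        mk_image_le.trans_lt (mk_Iio_toType_lt _)
      refine (mk_le_mk_of_subset ?_).trans_lt (hbdd _ hsub)
      rintro x ⟨hxa, hxb⟩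
      obtain ⟨i, -, ⟨⟨hxf, -, hxj⟩, hxN⟩⟩ := Set.mem_iUnion₂.1 hxa
      obtain ⟨i', -, ⟨⟨hxf', -, hxj'⟩, -⟩⟩ := Set.mem_iUnion₂.1 hxb
      have hxj : h x = j a i := hxj
      have hxj' : h x = j b i' := hxj'
      have hii : i = i' := hjinj a (by rw [← hxj, hxj', hτj a b hτ])
      subst hii
      refine ⟨i, ?_, hxj.symm⟩
      by_contra hlt
      exact hxN (Set.mem_biUnion (show b ∈ {b | b ∈ N a i ∧ τ b = τ a} from
        ⟨⟨hba, not_lt.1 hlt⟩, hτ.symm⟩) ⟨hxf', hxf⟩)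
    · refine (mk_le_mk_of_subset ?_).trans_lt (hbdd _ (htAD _ _ hτ hc))
      rintro x ⟨hxa, hxb⟩
      obtain ⟨i, hi, ⟨⟨-, -, hxj⟩, -⟩⟩ := Set.mem_iUnion₂.1 hxa
      obtain ⟨i', hi', ⟨⟨-, -, hxj'⟩, -⟩⟩ := Set.mem_iUnion₂.1 hxb
      have hxj : h x = j a i := hxj
      have hxj' : h x = j b i' := hxj'
      refine ⟨?_, ?_⟩
      · rw [hxj]
        exact hi
      · rw [hxj']
        exact hi'

/-! ### Closure properties -/

theorem exists_le_of_antitone_aleph0 {P : Type u} [Preorder P] [Nonempty P]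
    (γ : (ℵ₀ : Cardinal.{u}).ord.ToType) (f : (ℵ₀ : Cardinal.{u}).ord.ToType → P)
    (hf : ∀ β β', β ≤ β' → β' < γ → f β' ≤ f β) : ∃ p, ∀ β < γ, p ≤ f β := by
  by_cases h : (Set.Iio γ).Nonempty
  · have hfin : (Set.Iio γ).Finite := lt_aleph0_iff_set_finite.1 (mk_Iio_toType_lt γ)
    obtain ⟨β₀, hβ₀, hmax⟩ := Set.exists_max_image (Set.Iio γ) id hfin h
    exact ⟨f β₀, fun β hβ => hf β β₀ (hmax β hβ) hβ₀⟩
  · exact ⟨Classical.arbitrary P, fun β hβ => absurd ⟨β, hβ⟩ h⟩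

theorem mk_biUnion_nat_lt {X : Type u} {κ : Cardinal.{u}} (hκ : ℵ₀ ≤ κ) {t : ℕ → Set X}
    (ht : ∀ n, #(t n) < κ) (n : ℕ) : #(⋃ k ∈ Set.Iio n, t k : Set X) < κ := by
  induction n with
  | zero => simpa using aleph0_pos.trans_le hκ
  | succ n ih =>
    refine ((mk_le_mk_of_subset ?_).trans (mk_union_le _ _)).trans_lt (add_lt_of_lt hκ ih (ht n))
    refine Set.iUnion₂_subset fun k hk x hx => ?_
    rcases (Nat.lt_succ_iff.1 hk).eq_or_lt with rfl | h
    · exact Or.inr hx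
    · exact Or.inl (Set.mem_biUnion (show k ∈ Set.Iio n from h) hx)

theorem exists_nat_cofinal {κ : Cardinal.{u}} (hcof : κ.ord.cof = ℵ₀) :
    ∃ ρ : ℕ → Cardinal.{u}, (∀ n, ρ n < κ) ∧ ∀ d < κ, ∃ n, d ≤ ρ n := by
  obtain ⟨s, hs, hs'⟩ := Order.exists_cof_eq κ.ord.ToType
  rw [Ordinal.cof_toType, hcof] at hs'
  obtain ⟨_⟩ := denumerable_iff.2 hs'
  let y : ℕ ≃ s := (Denumerable.eqv s).symm
  refine ⟨fun n => #(Set.Iio (y n : κ.ord.ToType)), fun n => mk_Iio_toType_lt _, fun d hd => ?_⟩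
  obtain ⟨z, hz⟩ := Ordinal.typein_surj (α := κ.ord.ToType) (· < ·) (o := d.ord) (by simpa using hd)
  have hzd : #(Set.Iio z) = d := by
    have h := congrArg Ordinal.card hz
    rw [card_ord] at h
    exact h
  obtain ⟨w, hw, hzw⟩ := hs z
  obtain ⟨n, hn⟩ := y.surjective ⟨w, hw⟩
  refine ⟨n, hzd.symm.le.trans (mk_le_mk_of_subset ?_)⟩
  rw [hn]
  exact Set.Iio_subset_Iio hzw

/-- A decreasing sequence of large sets has a large pseudo-intersection if the cofinality is
countable. -/
theorem exists_pseudo_intersection {X : Type u} {κ : Cardinal.{u}} (hκ : ℵ₀ ≤ κ)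
    (hcof : κ.ord.cof = ℵ₀) (F : ℕ → Set X) (hF : ∀ n, κ ≤ #(F n))
    (hdec : ∀ n m, n ≤ m → #(F m \ F n : Set X) < κ) :
    ∃ q : Set X, κ ≤ #q ∧ ∀ n, #(q \ F n : Set X) < κ := by
  obtain ⟨ρ, hρ, hsup⟩ := exists_nat_cofinal hcof
  have hq : ∀ n, ∃ q : Set X, (∀ k ≤ n, q ⊆ F k) ∧ #q = ρ n := by
    intro n
    -- The `min` only makes the smallness of the differences available for all `k`; for the relevant
    -- `k ≤ n` it equals `k`.
    have hsmall : #(⋃ k ∈ Set.Iio (n + 1), (F n \ F (min k n)) : Set X) < κ :=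
      mk_biUnion_nat_lt hκ (fun k => hdec _ _ (min_le_right k n)) _
    obtain ⟨q, hqs, hq⟩ := le_mk_iff_exists_subset.1
      ((hρ n).le.trans (le_mk_sdiff hκ (hF n) hsmall))
    refine ⟨q, fun k hk x hx => ?_, hq⟩
    by_contra hxk
    refine (hqs hx).2 (Set.mem_biUnion (show k ∈ Set.Iio (n + 1) from Nat.lt_succ_iff.2 hk)
      ⟨(hqs hx).1, ?_⟩)
    rwa [min_eq_left hk]
  choose q hqF hq using hq
  refine ⟨⋃ n, q n, ?_, fun n => ?_⟩
  · by_contra! hlt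
    -- Since `κ` is not a successor cardinal, the successor of a size below `κ` is still below `κ`
    -- and so is dominated by some `ρ n`.
    have hsucc : Order.succ #(⋃ n, q n : Set X) ≠ κ := by
      intro heq
      rcases le_or_gt ℵ₀ #(⋃ n, q n : Set X) with h | h
      · have h₁ := (isRegular_succ h).cof_ord
        rw [heq, hcof] at h₁
        exact (h₁ ▸ h).not_gt hlt
      · exact (heq ▸ isSuccLimit_aleph0.succ_lt h).not_ge hκ
    obtain ⟨n, hn⟩ := hsup _ ((Order.succ_le_of_lt hlt).lt_of_ne hsucc)
    have h₁ : #(q n) ≤ #(⋃ n, q n : Set X) := mk_le_mk_of_subset (Set.subset_iUnion q n)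
    rw [hq] at h₁
    exact (hn.trans h₁).not_gt (Order.lt_succ _)
  · refine (mk_le_mk_of_subset ?_).trans_lt
      (mk_biUnion_nat_lt hκ (t := q) (fun k => by rw [hq]; exact hρ k) n)
    rintro x ⟨hx, hxn⟩
    obtain ⟨k, hk⟩ := Set.mem_iUnion.1 hx
    refine Set.mem_biUnion (show k ∈ Set.Iio n from ?_) hk
    by_contra hkn
    exact hxn (hqF k n (not_lt.1 hkn) hk)

theorem nonempty_posSet {X : Type u} {κ : Cardinal.{u}} (hκ : ℵ₀ ≤ κ) (hX : #X = κ) :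
    Nonempty (PosSet (smallIdeal κ hκ X)) := by
  refine ⟨⟨(Set.univ : Set X), fun h => ?_⟩⟩
  have h : #(Set.univ : Set X) < κ := h
  rw [mk_univ, hX] at h
  exact h.false

theorem exists_le_of_antitone_aleph_one {X : Type u} {κ : Cardinal.{u}} (hκ : ℵ₀ ≤ κ)
    (hX : #X = κ) (hcof : κ.ord.cof = ℵ₀) (γ : (ℵ₁ : Cardinal.{u}).ord.ToType)
    (f : (ℵ₁ : Cardinal.{u}).ord.ToType → PosSet (smallIdeal κ hκ X))
    (hf : ∀ β β', β ≤ β' → β' < γ → f β' ≤ f β) : ∃ p, ∀ β < γ, p ≤ f β := by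
  by_cases h : (Set.Iio γ).Nonempty
  · have hcount : (Set.Iio γ).Countable := by
      rw [← le_aleph0_iff_set_countable, ← Order.lt_succ_iff, succ_aleph0]
      exact mk_Iio_toType_lt γ
    obtain ⟨g, hg⟩ := hcount.exists_eq_range h
    have hgγ : ∀ n, g n < γ := fun n => by
      have : g n ∈ Set.Iio γ := hg ▸ ⟨n, rfl⟩
      exact this
    have hmγ : ∀ n, partialSups g n < γ := fun n => by
      induction n with
      | zero => simpa using hgγ 0
      | succ n ih =>
        rw [partialSups_add_one]
        exact sup_lt_iff.2 ⟨ih, hgγ _⟩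
    -- Partial suprema turn the enumeration of the countable initial segment into a monotone
    -- sequence cofinal in it.
    obtain ⟨q, hq, hqF⟩ := exists_pseudo_intersection hκ hcof
      (fun n => PosSet.set (f (partialSups g n))) (fun n => not_lt.1 (f (partialSups g n)).2)
      (fun n m hnm => hf _ _ ((partialSups g).monotone hnm) (hmγ m))
    refine ⟨⟨q, not_lt.2 hq⟩, fun β hβ => ?_⟩
    obtain ⟨n, rfl⟩ : β ∈ Set.range g := hg ▸ hβ
    exact le_trans (b := f (partialSups g n)) (hqF n) (hf _ _ (le_partialSups g n) (hmγ n))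
  · exact ⟨(nonempty_posSet hκ hX).some, fun β hβ => absurd ⟨β, hβ⟩ h⟩

/-! ### Large antichains -/

/-- Below every large set there is an almost disjoint family of size `κ⁺`, for regular `κ`. -/
theorem exists_almost_disjoint_succ {X : Type u} {κ : Cardinal.{u}} (hκ : κ.IsRegular)
    (p : Set X) (hp : κ ≤ #p) :
    ∃ g : (Order.succ κ).ord.ToType → Set X, (∀ a, g a ⊆ p ∧ κ ≤ #(g a)) ∧
      ∀ a b, a ≠ b → #(g a ∩ g b : Set X) < κ := by
  have hω := hκ.aleph0_le
  obtain ⟨q, hqp, hq⟩ := le_mk_iff_exists_subset.1 hp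
  obtain ⟨e⟩ : Nonempty (κ.ord.ToType × κ.ord.ToType ≃ q) := Cardinal.eq.1 (by
    simp [hq, mul_eq_self hω])
  let B : κ.ord.ToType → Set X := fun i => Set.range fun j => (e (i, j) : X)
  have hBmk : ∀ i, #(B i) = κ := fun i => by
    rw [mk_range_eq _ fun j j' h => congrArg Prod.snd (e.injective (Subtype.ext h))]
    simp
  have hBdisj : ∀ i j, i ≠ j → #(B i ∩ B j : Set X) < κ := by
    intro i j hij
    have : B i ∩ B j = ∅ := by
      rw [Set.eq_empty_iff_forall_notMem]
      rintro x ⟨⟨k, rfl⟩, l, hl⟩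
      exact hij (congrArg Prod.fst (e.injective (Subtype.ext hl))).symm
    rw [this]
    simpa using hκ.pos
  have hBinj : Function.Injective B := by
    intro i j h
    by_contra hne
    have h₁ := hBdisj i j hne
    rw [h, Set.inter_self, hBmk] at h₁
    exact h₁.false
  obtain ⟨s, hs₀, hsS, hsp, hmax⟩ := exists_maximal_pairwise
    (fun A B : Set X => #(A ∩ B : Set X) < κ) {A | A ⊆ p ∧ κ ≤ #A} (Set.range B)
    (by
      rintro _ ⟨i, rfl⟩
      refine ⟨?_, (hBmk i).ge⟩
      rintro _ ⟨j, rfl⟩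
      exact hqp (e (i, j)).2)
    (by
      rintro _ ⟨i, rfl⟩ _ ⟨j, rfl⟩ hne
      exact hBdisj i j fun h => hne (h ▸ rfl))
  have hκs : κ ≤ #s := by
    refine le_trans ?_ (mk_le_mk_of_subset hs₀)
    rw [mk_range_eq B hBinj]
    simp
  -- Starting from `κ` disjoint sets keeps the maximal family from being small, and diagonalization
  -- excludes size exactly `κ`.
  have hsκ : κ ≠ #s := by
    intro heq
    obtain ⟨r, hrp, hr, hrs⟩ := exists_almost_disjoint hκ heq.symm
      (fun A hA B hB => hsp hA hB) (p := p) (fun B hB => by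
        rw [Set.inter_eq_left.2 (hsS hB).1]
        exact (hsS hB).2)
    by_cases hrmem : r ∈ s
    · have := hrs r hrmem
      rw [Set.inter_self] at this
      exact this.not_ge hr
    · obtain ⟨y, hy, -, hyr⟩ := hmax r ⟨hrp, hr⟩ hrmem
      rw [Set.inter_comm r y, and_self] at hyr
      exact hyr (hrs y hy)
  obtain ⟨g⟩ : Nonempty ((Order.succ κ).ord.ToType ↪ s) := by
    rw [← Cardinal.le_def]
    simpa using Order.succ_le_of_lt (hκs.lt_of_ne hsκ)
  exact ⟨fun a => g a, fun a => hsS (g a).2, fun a b hab =>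
    hsp (g a).2 (g b).2 fun h => hab (g.injective (Subtype.ext h))⟩

/-! ### Collapsing -/

theorem mk_posSet_le {X : Type u} {κ : Cardinal.{u}} (hκ : ℵ₀ ≤ κ) (hX : #X = κ) :
    #(PosSet (smallIdeal κ hκ X)) ≤ 2 ^ κ := by
  refine (mk_subtype_le _).trans ?_
  change #(Set X) ≤ _
  rw [mk_set, hX]

theorem not_compat_posSet {X : Type u} {κ : Cardinal.{u}} {hκ : ℵ₀ ≤ κ}
    {A B : PosSet (smallIdeal κ hκ X)} (h : #(A.set ∩ B.set : Set X) < κ) : ¬ Compat A B := by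
  rw [PosSet.compat_iff, not_not]
  exact h

theorem nonempty_posSet_col_of_hasRefinement {X : Type u} {κ : Cardinal.{u}} (hκ : ℵ₀ ≤ κ)
    (hX : #X = κ) (h2 : 2 ^ κ = Order.succ κ) {C : Type u} (hC : HasRefinement κ C)
    (θ : Cardinal.{u}) (hθ : ℵ₀ ≤ θ) (hCθ : #C ≤ θ) (hθκ : θ ≤ κ)
    (hclosed : ∀ (γ : θ.ord.ToType) (f : θ.ord.ToType → PosSet (smallIdeal κ hκ X)),
      (∀ β β', β ≤ β' → β' < γ → f β' ≤ f β) → ∃ p, ∀ β < γ, p ≤ f β) :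
    Nonempty (RO (PosSet (smallIdeal κ hκ X)) ≃o RO (CollTree θ (2 ^ κ))) := by
  have hP := mk_posSet_le hκ hX
  have hreg := isRegular_succ hκ
  rw [h2] at hP ⊢
  have hne := nonempty_posSet hκ hX
  have hΛ : #(Order.succ κ).ord.ToType = Order.succ κ := by simp
  have hneΛ : Nonempty (Order.succ κ).ord.ToType := by
    rw [← mk_ne_zero_iff, hΛ]
    exact hreg.pos.ne'
  -- Every large set is listed `κ⁺` times. One copy provides the colouring of the order; among all
  -- copies some colour recurs `κ⁺` times, which gives the large antichain below the set.
  obtain ⟨c, r, hr, hAD⟩ := hC X (PosSet (smallIdeal κ hκ X) × (Order.succ κ).ord.ToType) hX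
    (by
      rw [mk_prod, lift_id, lift_id, hΛ]
      exact (mul_le_mul' hP le_rfl).trans (mul_eq_self hreg.aleph0_le).le)
    (fun a => PosSet.set a.1) (fun a => not_lt.1 a.1.2)
  obtain ⟨g⟩ : Nonempty (C ↪ θ.ord.ToType) := by
    rw [← Cardinal.le_def]
    simpa using hCθ
  let R : PosSet (smallIdeal κ hκ X) × (Order.succ κ).ord.ToType → PosSet (smallIdeal κ hκ X) :=
    fun a => ⟨r a, not_lt.2 (hr a).2⟩
  have hRle : ∀ a, R a ≤ a.1 := by
    intro a
    refine (smallIdeal κ hκ X).lower ?_ (smallIdeal κ hκ X).bot_mem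
    rintro x ⟨hx, hx'⟩
    exact hx' ((hr a).1 hx)
  have hRc : ∀ a b, a ≠ b → c a = c b → ¬ Compat (R a) (R b) := fun a b hab hc =>
    not_compat_posSet (hAD a b hab hc)
  let α₀ : (Order.succ κ).ord.ToType := Classical.arbitrary _
  refine nonempty_ro_col θ (Order.succ κ) hθ hreg.pos.ne' hP hclosed ?_
    (fun A => g (c (A, α₀))) (fun A => R (A, α₀)) (fun A => hRle _) fun A B hAB hc =>
      hRc _ _ (fun h => hAB (congrArg Prod.fst h)) (g.injective hc)
  intro A
  obtain ⟨d, hd⟩ := infinite_pigeonhole (fun α => c (A, α)) (by rw [hΛ]; exact hreg.aleph0_le) (by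
    rw [hΛ, hreg.cof_ord]
    exact Order.lt_succ_iff.2 (hCθ.trans hθκ))
  obtain ⟨e⟩ := Cardinal.eq.1 hd.symm
  refine ⟨fun α => R (A, e α), fun α => hRle _, fun α β hαβ => hRc _ _ (fun h => hαβ ?_) ?_⟩
  · exact e.injective (Subtype.ext (congrArg Prod.snd h))
  · exact (e α).2.trans (e β).2.symm

/-- For `κ` of uncountable cofinality, the sets of size `κ` modulo small sets collapse to `ω`. -/
theorem nonempty_posSet_col_aleph0 {X : Type u} {κ : Cardinal.{u}} (hκ : ℵ₀ ≤ κ) (hX : #X = κ)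
    (h2 : 2 ^ κ = Order.succ κ) (h2' : 2 ^ κ.ord.cof = Order.succ κ.ord.cof)
    (hcof : ℵ₀ < κ.ord.cof) :
    Nonempty (RO (PosSet (smallIdeal κ hκ X)) ≃o RO (CollTree ℵ₀ (2 ^ κ))) := by
  have hne := nonempty_posSet hκ hX
  have hμreg : κ.ord.cof.IsRegular := isRegular_cof (isSuccLimit_ord hκ)
  have hC : HasRefinement κ (ULift.{u} ℕ) := by
    rcases (Ordinal.cof_ord_le κ).eq_or_lt with h | h
    · rw [h] at hμreg hcof
      exact hasRefinement_of_isRegular hμreg hcof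
    · refine hasRefinement_of_cof_lt hκ h ?_
      have hω := hμreg.aleph0_le
      exact hasRefinement_of_isRegular hμreg hcof κ.ord.cof.ord.ToType
        (Shape κ.ord.cof.ord.ToType) (by simp) ((mk_shape_le hω).trans h2'.le)
        (fun σ => Set.range σ.1.1) fun σ => by
          rw [mk_range_eq _ σ.1.2]
          simp
  exact nonempty_posSet_col_of_hasRefinement hκ hX h2 hC ℵ₀ le_rfl (by simp) hκ
    exists_le_of_antitone_aleph0

/-- For `κ` of countable cofinality, the sets of size `κ` modulo small sets collapse to `ω₁`. -/
theorem nonempty_posSet_col_aleph_one {X : Type u} {κ : Cardinal.{u}} (hκ : ℵ₀ ≤ κ)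
    (hX : #X = κ) (h2 : 2 ^ κ = Order.succ κ) (h2' : 2 ^ κ.ord.cof = Order.succ κ.ord.cof)
    (hcof : κ.ord.cof = ℵ₀) :
    Nonempty (RO (PosSet (smallIdeal κ hκ X)) ≃o RO (CollTree ℵ₁ (2 ^ κ))) := by
  have hclosed := exists_le_of_antitone_aleph_one hκ hX hcof
  have hℵ₁ : (ℵ₀ : Cardinal.{u}) ≤ ℵ₁ := aleph0_lt_aleph_one.le
  rcases hκ.eq_or_lt with h | h
  · have hreg : κ.IsRegular := h ▸ isRegular_aleph0
    have hP := mk_posSet_le hκ hX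
    rw [h2] at hP ⊢
    obtain ⟨g⟩ : Nonempty (PosSet (smallIdeal κ hκ X) ↪ (ℵ₁ : Cardinal.{u}).ord.ToType) := by
      rw [← Cardinal.le_def, mk_ord_toType, ← succ_aleph0, h]
      exact hP
    have hne := nonempty_posSet hκ hX
    refine nonempty_ro_col ℵ₁ (Order.succ κ) hℵ₁ (isRegular_succ hκ).pos.ne' hP hclosed ?_
      g id (fun _ => le_rfl) fun A B hAB hg => absurd (g.injective hg) hAB
    intro A
    obtain ⟨f, hf, hAD⟩ := exists_almost_disjoint_succ hreg (PosSet.set A) (not_lt.1 A.2)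
    refine ⟨fun a => ⟨f a, not_lt.2 (hf a).2⟩, fun a => ?_, fun a b hab =>
      not_compat_posSet (hAD a b hab)⟩
    refine (smallIdeal κ hκ X).lower ?_ (smallIdeal κ hκ X).bot_mem
    rintro x ⟨hx, hx'⟩
    exact hx' ((hf a).1 hx)
  · have hC : HasRefinement κ (Shape κ.ord.cof.ord.ToType) := by
      refine hasRefinement_of_cof_lt hκ (hcof ▸ h) ⟨id, fun σ => Set.range σ.1.1,
        fun σ => ⟨subset_rfl, ?_⟩, fun σ τ hne heq => absurd heq hne⟩
      rw [mk_range_eq _ σ.1.2]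
      simp
    refine nonempty_posSet_col_of_hasRefinement hκ hX h2 hC ℵ₁ hℵ₁ ?_ ?_ hclosed
    · refine (mk_shape_le hcof.ge).trans ?_
      rw [h2', hcof, succ_aleph0]
    · rw [← succ_aleph0]
      exact Order.succ_le_of_lt h

theorem IsCopyMaximal.isCopyDense {L : FirstOrder.Language.{v, w}} {X : Type u} [L.Structure X]
    (h : IsCopyMaximal L X) : IsCopyDense L X := by
  intro A hA
  refine ⟨A, ?_, subset_rfl⟩
  rw [show copies L X = {A : Set X | #A = #X} from h]
  exact hA

end CopyPoset

theorem theorem3p2 {L : FirstOrder.Language.{v, w}} [L.IsRelational] (κ : Cardinal.{u}) (hκ : ℵ₀ ≤ κ)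
    (X : Type u) [L.Structure X] (hX : #X = κ)
    (hdense : CopyPoset.IsCopyDense L X ∨ CopyPoset.IsConstant L X ∨
      CopyPoset.IsCopyMaximal L X) :
    Nonempty (CopyPoset.BoolCopies L X ≃o CopyPoset.RO (CopyPoset.CP κ hκ)) ∧
    (κ = ℵ₀ → Nonempty (CopyPoset.BoolCopies L X ≃o
      CopyPoset.RO (CopyPoset.PosQuot CopyPoset.finIdeal))) ∧
    (2 ^ κ = Order.succ κ → 2 ^ κ.ord.cof = Order.succ κ.ord.cof →
      (ℵ₀ < κ.ord.cof → Nonempty (CopyPoset.BoolCopies L X ≃o CopyPoset.Col ℵ₀ (2 ^ κ))) ∧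
      (κ.ord.cof = ℵ₀ → Nonempty (CopyPoset.BoolCopies L X ≃o CopyPoset.Col ℵ₁ (2 ^ κ)))) := by
  have hinf : Infinite X := infinite_iff.2 (hX ▸ hκ)
  have hd : CopyPoset.IsCopyDense L X := by
    rcases hdense with h | h | h
    · exact h
    · exact h.isCopyDense
    · exact h.isCopyDense
  refine ⟨?_, ?_, fun h2 h2' => ?_⟩
  · obtain ⟨e⟩ : Nonempty (X ≃ κ.ord.ToType) := Cardinal.eq.1 (by simpa using hX)
    obtain ⟨f⟩ := CopyPoset.nonempty_boolCopies_posSet hd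
      (CopyPoset.smallIdeal κ hκ κ.ord.ToType) e fun A => by
        change #(e '' A) < κ ↔ _
        rw [mk_image_eq e.injective, hX]
    obtain ⟨g⟩ := (CopyPoset.isDenseEmb_posQuot
      (CopyPoset.smallIdeal κ hκ κ.ord.ToType)).nonempty_orderIso
    exact ⟨f.trans g⟩
  · rintro rfl
    obtain ⟨_⟩ := denumerable_iff.2 hX
    let e : X ≃ ℕ := Denumerable.eqv X
    obtain ⟨f⟩ := CopyPoset.nonempty_boolCopies_posSet hd CopyPoset.finIdeal e fun A => by
      change (e '' A).Finite ↔ _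
      rw [Set.finite_image_iff e.injective.injOn, hX, lt_aleph0_iff_set_finite]
    obtain ⟨g⟩ := (CopyPoset.isDenseEmb_posQuot CopyPoset.finIdeal).nonempty_orderIso
    exact ⟨f.trans g⟩
  · obtain ⟨f⟩ := CopyPoset.nonempty_boolCopies_posSet hd
      (CopyPoset.smallIdeal κ hκ X) (Equiv.refl X) fun A => by
        change #(Equiv.refl X '' A) < κ ↔ _
        rw [mk_image_eq (Equiv.refl X).injective, hX]
    refine ⟨fun hcof => ?_, fun hcof => ?_⟩
    · obtain ⟨g⟩ := CopyPoset.nonempty_posSet_col_aleph0 hκ hX h2 h2' hcof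
      obtain ⟨k⟩ := CopyPoset.nonempty_ro_sepQuot (CopyPoset.CollTree ℵ₀ (2 ^ κ))
      exact ⟨(f.trans g).trans k.symm⟩
    · obtain ⟨g⟩ := CopyPoset.nonempty_posSet_col_aleph_one hκ hX h2 h2' hcof
      obtain ⟨k⟩ := CopyPoset.nonempty_ro_sepQuot (CopyPoset.CollTree ℵ₁ (2 ^ κ))
      exact ⟨(f.trans g).trans k.symm⟩
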